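/- Theorem (stability of linearization-based tracking MPC). **Setting.** Consider the discrete-time system $x_{t+1}=f(x_t,u_t)=f_0(x_t)+Bu_t$ with output $y_t=h(x_t,u_t)=h_0(x_t)+Du_t$, where $x_t\in\mathbb{R}^n$, $u_t\in\mathbb{R}^m$, $y_t\in\mathbb{R}^p$. Let $\mathbb{U}\subset\mathbb{R}^m$ be compact, let $\mathbb{U}^s\subseteq\mathrm{int}(\mathbb{U})$ be convex and compact, let $y^r\in\mathbb{R}^p$ be a setpoint, and let $Q,R\succ0$ be symmetric. All norms are Euclidean, and $\|v\|_P^2:=v^\top Pv$. For $\tilde x\in\mathbb{R}^n$ let $A_{\tilde x}$, $C_{\tilde x}$ be the Jacobians of $f_0$, $h_0$ at $\tilde x$, $e_{\tilde x}:=f_0(\tilde x)-A_{\tilde x}\tilde x$, $r_{\tilde x}:=h_0(\tilde x)-C_{\tilde x}\tilde x$, and $$f_{\tilde x}(x,u):=A_{\tilde x}x+Bu+e_{\tilde x},\qquad h_{\tilde x}(x,u):=C_{\tilde x}x+Du+r_{\tilde x}.$$ Let $\mathcal{Z}^s:=\{(x,u)\in\mathbb{R}^n\times\mathbb{U}^s: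 x=f(x,u)\}$ and $\mathcal{Z}^s_{\rm lin}(\tilde x):=\{(x,u)\in\mathbb{R}^n\times\mathbb{U}^s: x=f_{\tilde x}(x,u)\}$. For symmetric $S\succ0$, let $(x^{sr},u^{sr})\in\mathcal{Z}^s$ be a minimizer of $\|h(x,u)-y^r\|_S^2$ over $\mathcal{Z}^s$ (the optimal reachable equilibrium of the nonlinear system). Let $J^*_{\rm eq,lin}(\tilde x)$ be the minimum of $\|h_{\tilde x}(x,u)-y^r\|_S^2$ over $\mathcal{Z}^s_{\rm lin}(\tilde x)$, attained at $(x^{sr}_{\rm lin}(\tilde x),u^{sr}_{\rm lin}(\tilde x))$. **MPC problem.** Given the current state $x_t$, minimize $$\sum_{k=0}^{N-1}\big(\|\bar x_k-x^s\|_Q^2+\|\bar u_k-u^s\|_R^2\big)+\|y^s-y^r\|_S^2$$ over $(\bar x,\bar u,x^s,u^s,y^s)$ subject to $\bar x_{k+1}=f_{x_t}(\bar x_k,\bar u_k)$ and $\bar u_k\in\mathbb{U}$ for $0\le k\le N-1$, $\bar x_0=x_t$, $\bar x_N=x^s$, $(x^s,u^s)\in\mathcal{Z}^s_{\rm lin}(x_t)$,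 and $y^s=h_{x_t}(x^s,u^s)$. Denote the optimal cost by $J_N^*(x_t)$ and let $V(x_t):=J_N^*(x_t)-J^*_{\rm eq,lin}(x_t)$, with $V(x_t)=+\infty$ if the problem is infeasible. In the $n$-step scheme, at each time $t=ni$, $i=0,1,2,\dots$, an optimal solution of the problem at $x_t$ is computed and its first $n$ inputs $\bar u^*_0,\dots,\bar u^*_{n-1}$ are applied to the nonlinear system. **Assumptions.** 1. $f_0$ and $h_0$ are twice continuously differentiable. 2. There is $\sigma_s>0$ such that, for all $\tilde x\in\mathbb{R}^n$, all $n+m$ singular values (one per column) of $\begin{bmatrix}A_{\tilde x}-I&B\\C_{\tilde x}&D\end{bmatrix}$ are at least $\sigma_s$ (in particular, this matrix has full column rank). 3. There is $\sigma_c>0$ such that, for all $\tilde x\in\mathbb{R}^n$, the $n$ largest singular values (one per row) of $\begin{bmatrix}B&A_{\tilde x}B&\cdots&A_{\tilde x}^{n-1}B\end{bmatrix}$ are at least $\sigma_c$. 4. There is $\underline\sigma>0$ such that $\sigma_{\min}(I-A_{\tilde x})\ge\underline\sigma$ for all $\tilde x\in\mathbb{R}^n$. 5. There is a compact set $\mathcal{B}\subseteq\mathbb{R}^n\times\mathbb{U}$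 with $\mathcal{Z}^s_{\rm lin}(\tilde x)\subseteq\mathcal{B}$ for all $\tilde x\in\mathbb{R}^n$. 6. For every compact $X\subset\mathbb{R}^n$ with $\mathcal{B}\subseteq X\times\mathbb{U}$ there are $c_{{\rm eq},1},c_{{\rm eq},2}>0$ such that for all $\hat x\in X$ $$c_{{\rm eq},1}\|\hat x-x^{sr}_{\rm lin}(\hat x)\|^2\le\|\hat x-x^{sr}\|^2\le c_{{\rm eq},2}\|\hat x-x^{sr}_{\rm lin}(\hat x)\|^2 .$$ **Claim.** Suppose $N\ge n$ and that Assumptions 1–5 hold. Then there exist $V_{\max}>0$ and $\bar S>0$ such that the following holds for every symmetric $S\succ0$ with $\lambda_{\max}(S)\le\bar S$ and every associated $x^{sr}$ for which Assumption 6 holds. There are constants $C>0$ and $0<c_V<1$ such that, for every trajectory $(x_t)$ of the nonlinear system under the $n$-step scheme with $V(x_0)\le V_{\max}$ (in particular, the MPC problem is feasible at time $0$), the MPC problem is feasible at every time $ni$, and $$\|x_{ni}-x^{sr}\|^2\le c_V^{\,i}\,C\,\|x_0-x^{sr}\|^2\qquad\text{for all } i\in\mathbb{N}_0 ;$$ that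 is, $x^{sr}$ is exponentially stable. -/

import Mathlib

open scoped Matrix

noncomputable section

/-- Real `d`-dimensional space with the Euclidean norm. -/
abbrev Vec (d : ℕ) : Type := EuclideanSpace ℝ (Fin d)

/-- The weighted square norm `‖v‖_P² = vᵀ P v`. -/
def sqNorm {d : ℕ} (P : Matrix (Fin d) (Fin d) ℝ) (v : Vec d) : ℝ :=
  v.ofLp ⬝ᵥ (P *ᵥ v.ofLp)

/-- The data of the control problem that do not depend on the setpoint weight `S`: the
control-affine dynamics `x⁺ = f₀ x + B u`, the output `y = h₀ x + D u`, the input constraint set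
`U`, the equilibrium input constraint set `Us`, the setpoint `yr`, the weights `Q`, `R` and the
horizon `N`. Linear maps between Euclidean spaces stand for matrices. -/
structure TrackingData (n m p : ℕ) where
  f₀ : Vec n → Vec n
  B : Vec m →L[ℝ] Vec n
  h₀ : Vec n → Vec p
  D : Vec m →L[ℝ] Vec p
  U : Set (Vec m)
  Us : Set (Vec m)
  yr : Vec p
  Q : Matrix (Fin n) (Fin n) ℝ
  R : Matrix (Fin m) (Fin m) ℝ
  N : ℕ

/-- A candidate `(x̄, ū, xˢ, uˢ, yˢ)` for the optimal control problem with horizon `N`. -/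
structure Candidate (n m p N : ℕ) where
  x : Fin (N + 1) → Vec n
  u : Fin N → Vec m
  xs : Vec n
  us : Vec m
  ys : Vec p

namespace TrackingData

variable {n m p : ℕ} (P : TrackingData n m p)

/-- The nonlinear dynamics. -/
def f (x : Vec n) (u : Vec m) : Vec n := P.f₀ x + P.B u

/-- The nonlinear output map. -/
def h (x : Vec n) (u : Vec m) : Vec p := P.h₀ x + P.D u

/-- The Jacobian of `f₀` at `z`. -/
def A (z : Vec n) : Vec n →L[ℝ] Vec n := fderiv ℝ P.f₀ z

/-- The Jacobian of `h₀` at `z`. -/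
def C (z : Vec n) : Vec n →L[ℝ] Vec p := fderiv ℝ P.h₀ z

/-- The offset of the dynamics linearized at `z`. -/
def e (z : Vec n) : Vec n := P.f₀ z - P.A z z

/-- The offset of the output linearized at `z`. -/
def r (z : Vec n) : Vec p := P.h₀ z - P.C z z

/-- The dynamics linearized at `(z, 0)`. -/
def fLin (z x : Vec n) (u : Vec m) : Vec n := P.A z x + P.B u + P.e z

/-- The output linearized at `(z, 0)`. -/
def hLin (z x : Vec n) (u : Vec m) : Vec p := P.C z x + P.D u + P.r z

/-- The feasible steady states of the nonlinear system. -/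
def Zs : Set (Vec n × Vec m) := {w | w.2 ∈ P.Us ∧ w.1 = P.f w.1 w.2}

/-- The feasible steady-state outputs of the nonlinear system. -/
def Zsy : Set (Vec p) := {y | ∃ w ∈ P.Zs, y = P.h w.1 w.2}

/-- The feasible steady states of the dynamics linearized at `z`. -/
def ZsLin (z : Vec n) : Set (Vec n × Vec m) := {w | w.2 ∈ P.Us ∧ w.1 = P.fLin z w.1 w.2}

/-- The feasible steady-state outputs of the system linearized at `z`. -/
def ZsyLin (z : Vec n) : Set (Vec p) := {y | ∃ w ∈ P.ZsLin z, y = P.hLin z w.1 w.2}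

/-- `(xsr, usr)` is an optimal reachable equilibrium of the nonlinear system: a steady state whose
output minimizes `‖yˢ - yʳ‖_S²` over all feasible steady-state outputs. -/
def IsOptEquil (S : Matrix (Fin p) (Fin p) ℝ) (xsr : Vec n) (usr : Vec m) : Prop :=
  (xsr, usr) ∈ P.Zs ∧ ∀ y ∈ P.Zsy, sqNorm S (P.h xsr usr - P.yr) ≤ sqNorm S (y - P.yr)

/-- `(x, u)` is an optimal reachable equilibrium of the system linearized at `z`. -/
def IsOptEquilLin (S : Matrix (Fin p) (Fin p) ℝ) (z x : Vec n) (u : Vec m) : Prop :=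
  (x, u) ∈ P.ZsLin z ∧ ∀ y ∈ P.ZsyLin z, sqNorm S (P.hLin z x u - P.yr) ≤ sqNorm S (y - P.yr)

/-- The optimal equilibrium cost of the system linearized at `z`. -/
def JeqLin (S : Matrix (Fin p) (Fin p) ℝ) (z : Vec n) : ℝ :=
  sInf ((fun y => sqNorm S (y - P.yr)) '' P.ZsyLin z)

/-! ### The optimal control problem and the closed loop -/

/-- The constraints of the optimal control problem at the current state `xt`. -/
structure IsFeasiblePoint (xt : Vec n) (c : Candidate n m p P.N) : Prop where
  dyn : ∀ k : Fin P.N, c.x k.succ = P.fLin xt (c.x k.castSucc) (c.u k)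
  init : c.x 0 = xt
  terminal : c.x (Fin.last P.N) = c.xs
  input : ∀ k, c.u k ∈ P.U
  equil : (c.xs, c.us) ∈ P.ZsLin xt
  output : c.ys = P.hLin xt c.xs c.us

/-- The cost of the optimal control problem. -/
def cost (S : Matrix (Fin p) (Fin p) ℝ) (c : Candidate n m p P.N) : ℝ :=
  ∑ k : Fin P.N, (sqNorm P.Q (c.x k.castSucc - c.xs) + sqNorm P.R (c.u k - c.us))
    + sqNorm S (c.ys - P.yr)

/-- The optimal control problem at the current state `xt` is feasible. -/
def Feasible (xt : Vec n) : Prop := ∃ c, P.IsFeasiblePoint xt c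

/-- `c` is an optimal solution of the optimal control problem at the current state `xt`. -/
def IsOptimal (S : Matrix (Fin p) (Fin p) ℝ) (xt : Vec n) (c : Candidate n m p P.N) : Prop :=
  P.IsFeasiblePoint xt c ∧ ∀ c', P.IsFeasiblePoint xt c' → P.cost S c ≤ P.cost S c'

/-- The optimal cost (used only at states where the problem is feasible). -/
def JN (S : Matrix (Fin p) (Fin p) ℝ) (xt : Vec n) : ℝ :=
  sInf (P.cost S '' {c | P.IsFeasiblePoint xt c})

/-- The Lyapunov function candidate (used only at states where the problem is feasible). -/
def V (S : Matrix (Fin p) (Fin p) ℝ) (xt : Vec n) : ℝ := P.JN S xt - P.JeqLin S xt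

/-- `(x, u)` is a trajectory of the nonlinear system under the `n`-step scheme: at each time
`n * i` at which the optimal control problem has an optimal solution, the first `n` inputs of an
optimal solution are applied. Nothing is assumed about the inputs otherwise, so feasibility along
the trajectory is not presupposed. -/
structure IsClosedLoop (S : Matrix (Fin p) (Fin p) ℝ) (x : ℕ → Vec n) (u : ℕ → Vec m) : Prop where
  dyn : ∀ t, x (t + 1) = P.f (x t) (u t)
  input : ∀ i, (∃ c, P.IsOptimal S (x (n * i)) c) →
    ∃ c, P.IsOptimal S (x (n * i)) c ∧ ∀ k : Fin P.N, (k : ℕ) < n → u (n * i + k) = c.u k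

/-! ### The assumptions -/

/-- Standing requirements on the constraint sets and on the weights. -/
structure Standing : Prop where
  compact_U : IsCompact P.U
  convex_Us : Convex ℝ P.Us
  compact_Us : IsCompact P.Us
  Us_subset : P.Us ⊆ interior P.U
  posDef_Q : P.Q.PosDef
  posDef_R : P.R.PosDef

/-- The vector fields are twice continuously differentiable. -/
def Smooth : Prop := ContDiff ℝ 2 P.f₀ ∧ ContDiff ℝ 2 P.h₀

/-- The block matrix `[A z - I, B; C z, D]`, as a linear map for the Euclidean norms. -/
def blockMap (z : Vec n) : WithLp 2 (Vec n × Vec m) →ₗ[ℝ] WithLp 2 (Vec n × Vec p) :=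
  (WithLp.linearEquiv 2 ℝ (Vec n × Vec p)).symm.toLinearMap ∘ₗ
    ((((P.A z - 1).coprod P.B).prod ((P.C z).coprod P.D) :
      Vec n × Vec m →L[ℝ] Vec n × Vec p) : Vec n × Vec m →ₗ[ℝ] Vec n × Vec p) ∘ₗ
    (WithLp.linearEquiv 2 ℝ (Vec n × Vec m)).toLinearMap

/-- The controllability matrix `[B, A z B, …, (A z)ⁿ⁻¹ B]`, as a linear map for the Euclidean
norms. -/
def ctrbMap (z : Vec n) : PiLp 2 (fun _ : Fin n => Vec m) →ₗ[ℝ] Vec n :=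
  ((∑ k : Fin n, (P.A z ^ (k : ℕ)) ∘L P.B ∘L
    (PiLp.proj 2 (fun _ : Fin n => Vec m) k : PiLp 2 (fun _ : Fin n => Vec m) →L[ℝ] Vec m) :
      PiLp 2 (fun _ : Fin n => Vec m) →L[ℝ] Vec n) : PiLp 2 (fun _ : Fin n => Vec m) →ₗ[ℝ] Vec n)

/-- Unique steady state: the `n + m` singular values of the block matrix (one per column) are
bounded below, uniformly in the linearization point. -/
def UniqueSteadyState : Prop :=
  ∃ σ : ℝ, 0 < σ ∧ ∀ z, ∀ i < n + m, σ ≤ (P.blockMap z).singularValues i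

/-- Uniform controllability: the first `n` singular values of the controllability matrix (one per
row) are bounded below, uniformly in the linearization point. -/
def UniformlyControllable : Prop :=
  ∃ σ : ℝ, 0 < σ ∧ ∀ z, ∀ i < n, σ ≤ (P.ctrbMap z).singularValues i

/-- Non-singular dynamics: the singular values of `I - A z` are bounded below, uniformly in the
linearization point. -/
def NonsingularDynamics : Prop :=
  ∃ σ : ℝ, 0 < σ ∧ ∀ z, ∀ i < n, σ ≤ ((1 - P.A z : Vec n →L[ℝ] Vec n) : Vec n →ₗ[ℝ] Vec n).singularValues i

/-- Compact steady-state manifold, with the compact set `K ⊆ ℝⁿ × U`. -/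
def CompactSteadyStates (K : Set (Vec n × Vec m)) : Prop :=
  IsCompact K ∧ K ⊆ Set.univ ×ˢ P.U ∧ ∀ z, P.ZsLin z ⊆ K

/-- On every compact set `X` with `K ⊆ X × U`, the distance of a state to `xsr` is equivalent to
its distance to the optimal reachable equilibrium of the system linearized at that state. -/
def DistancesEquivalent (S : Matrix (Fin p) (Fin p) ℝ) (K : Set (Vec n × Vec m)) (xsr : Vec n) :
    Prop :=
  ∀ X : Set (Vec n), IsCompact X → K ⊆ X ×ˢ P.U →
    ∃ c₁ c₂ : ℝ, 0 < c₁ ∧ 0 < c₂ ∧ ∀ z ∈ X, ∀ x u, P.IsOptEquilLin S z x u →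
      c₁ * ‖z - x‖ ^ 2 ≤ ‖z - xsr‖ ^ 2 ∧ ‖z - xsr‖ ^ 2 ≤ c₂ * ‖z - x‖ ^ 2

end TrackingData

end

/-! Let J be the optimal cost at the states x_{ni}, T its tracking part (J minus the setpoint term),
and Js the setpoint cost of the optimal equilibrium of the nonlinear system. The Lyapunov function
is J - Js. The function `V` enters only at time zero: it bounds T there, and a small S then puts J
below a level τ.

Decrease (`exists_cost_decrease`): J⁺ ≤ J - κ T. All predicted deviations from the artificial steady
state are O(√T). Since Taylor remainders are quadratic, the prediction error over n steps and the
change of steady state and output caused by relinearizing (`exists_transfer`) are O(T). The shifted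
plan with the same uˢ, corrected over its last n steps by controllability (`exists_steering`),
therefore perturbs the tracking cost by O(T^{3/2}) and the setpoint cost by at most λ_max(S) O(T).
The stages dropped by the shift cost at least 4κT, because T ≤ Γ‖x - xˢ‖² by optimality. Small T and
small S thus give the decrease, and with it recursive feasibility and invariance of {J ≤ τ}.

Comparison (`exists_optimal_cost_estimates`): ‖x - xsr‖² ≤ C₁ T, J - Js ≤ C₂ ‖x - xsr‖² and Js ≤ J +
C₃ T. The first rests on strong convexity of the setpoint cost in the steady state: were xˢ far from
the linearized optimum compared with ‖x - xˢ‖, a small move towards that optimum would lower the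
cost (`exists_dist_optEquilLin_le`). Equivalence of distances then passes to xsr.

Conclusion (`geometric_decay_of_cost_decrease`): J - Js might be negative, as Js belongs to another
model. But ΣT is finite, so T → 0, and the third estimate forces J ≥ Js along the closed loop. Hence
κT ≤ J - Js ≤ C₁C₂T, and J - Js decays geometrically. -/

/-! ### Quadratic forms -/

section QuadraticForms

open scoped InnerProductSpace

variable {d : ℕ}

theorem sqNorm_eq_inner (P : Matrix (Fin d) (Fin d) ℝ) (v : Vec d) :
    sqNorm P v = ⟪v, Matrix.toEuclideanCLM (𝕜 := ℝ) P v⟫_ℝ :=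
  (Matrix.inner_toEuclideanCLM P v v).symm

theorem sqNorm_zero (P : Matrix (Fin d) (Fin d) ℝ) : sqNorm P 0 = 0 := by
  simp [sqNorm]

theorem sqNorm_nonneg {P : Matrix (Fin d) (Fin d) ℝ} (hP : P.PosDef) (v : Vec d) :
    0 ≤ sqNorm P v := by
  simpa [sqNorm] using hP.posSemidef.dotProduct_mulVec_nonneg v.ofLp

theorem continuous_sqNorm (P : Matrix (Fin d) (Fin d) ℝ) : Continuous (sqNorm P) := by
  simp only [funext (sqNorm_eq_inner P)]
  fun_prop

theorem sqNorm_add_le (P : Matrix (Fin d) (Fin d) ℝ) {M : ℝ}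
    (hM : ‖Matrix.toEuclideanCLM (𝕜 := ℝ) P‖ ≤ M) (v w : Vec d) :
    sqNorm P (v + w) ≤ sqNorm P v + M * (2 * ‖v‖ * ‖w‖ + ‖w‖ ^ 2) := by
  have key (x y : Vec d) : ⟪x, Matrix.toEuclideanCLM (𝕜 := ℝ) P y⟫_ℝ ≤ M * ‖x‖ * ‖y‖ := by
    calc _ ≤ ‖x‖ * ‖Matrix.toEuclideanCLM (𝕜 := ℝ) P y‖ := real_inner_le_norm _ _
      _ ≤ ‖x‖ * (M * ‖y‖) := by
        gcongr
        exact ContinuousLinearMap.le_of_opNorm_le _ hM y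
      _ = _ := by ring
  simp only [sqNorm_eq_inner, map_add, inner_add_left, inner_add_right]
  nlinarith [key v w, key w v, key w w]

theorem sqNorm_le (P : Matrix (Fin d) (Fin d) ℝ) {M : ℝ}
    (hM : ‖Matrix.toEuclideanCLM (𝕜 := ℝ) P‖ ≤ M) (v : Vec d) :
    sqNorm P v ≤ M * ‖v‖ ^ 2 := by
  simpa [sqNorm_zero] using sqNorm_add_le P hM 0 v

theorem inner_eigenvectorBasis_toEuclideanCLM {P : Matrix (Fin d) (Fin d) ℝ} (hP : P.IsHermitian)
    (i : Fin d) (v : Vec d) :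
    ⟪hP.eigenvectorBasis i, Matrix.toEuclideanCLM (𝕜 := ℝ) P v⟫_ℝ =
      hP.eigenvalues i * ⟪hP.eigenvectorBasis i, v⟫_ℝ := by
  have hsa : IsSelfAdjoint (Matrix.toEuclideanCLM (𝕜 := ℝ) P) :=
    IsSelfAdjoint.map hP.isSelfAdjoint _
  rw [← ContinuousLinearMap.adjoint_inner_left, ← ContinuousLinearMap.star_eq_adjoint, hsa.star_eq]
  have : Matrix.toEuclideanCLM (𝕜 := ℝ) P (hP.eigenvectorBasis i) =
      hP.eigenvalues i • hP.eigenvectorBasis i := by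
    ext j
    rw [Matrix.ofLp_toEuclideanCLM, hP.mulVec_eigenvectorBasis]
    simp
  rw [this, real_inner_smul_left]

theorem norm_toEuclideanCLM_le {P : Matrix (Fin d) (Fin d) ℝ} (hP : P.PosDef) {M : ℝ}
    (hM₀ : 0 ≤ M) (hM : ∀ i, hP.isHermitian.eigenvalues i ≤ M) :
    ‖Matrix.toEuclideanCLM (𝕜 := ℝ) P‖ ≤ M := by
  refine ContinuousLinearMap.opNorm_le_bound _ hM₀ fun v => ?_
  refine le_of_sq_le_sq ?_ (by positivity)
  rw [mul_pow, ← hP.isHermitian.eigenvectorBasis.sum_sq_norm_inner_right,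
    ← hP.isHermitian.eigenvectorBasis.sum_sq_norm_inner_right, Finset.mul_sum]
  refine Finset.sum_le_sum fun i _ => ?_
  rw [inner_eigenvectorBasis_toEuclideanCLM, norm_mul, mul_pow, Real.norm_eq_abs, sq_abs]
  have := hP.posSemidef.eigenvalues_nonneg i
  gcongr
  exact hM i

theorem exists_pos_mul_norm_sq_le_sqNorm {P : Matrix (Fin d) (Fin d) ℝ} (hP : P.PosDef) :
    ∃ c : ℝ, 0 < c ∧ ∀ v, c * ‖v‖ ^ 2 ≤ sqNorm P v := by
  obtain ⟨c, hc, hle⟩ : ∃ c : ℝ, 0 < c ∧ ∀ i, c ≤ hP.isHermitian.eigenvalues i := by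
    rcases isEmpty_or_nonempty (Fin d) with h | h
    · exact ⟨1, one_pos, fun i => h.elim i⟩
    · obtain ⟨i, hi⟩ := Finite.exists_min hP.isHermitian.eigenvalues
      exact ⟨_, hP.eigenvalues_pos i, hi⟩
  refine ⟨c, hc, fun v => ?_⟩
  rw [sqNorm_eq_inner, ← hP.isHermitian.eigenvectorBasis.sum_inner_mul_inner,
    ← hP.isHermitian.eigenvectorBasis.sum_sq_norm_inner_right, Finset.mul_sum]
  refine Finset.sum_le_sum fun i _ => ?_
  rw [inner_eigenvectorBasis_toEuclideanCLM, real_inner_comm, Real.norm_eq_abs, sq_abs]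
  nlinarith [hle i, sq_nonneg ⟪hP.isHermitian.eigenvectorBasis i, v⟫_ℝ]

/-- Expansion suffices, without symmetry. The last term is the strong convexity gain that makes
moving towards an optimum profitable. -/
theorem sqNorm_convexCombination {P : Matrix (Fin d) (Fin d) ℝ} (v w : Vec d) (b : ℝ) :
    sqNorm P ((1 - b) • v + b • w) =
      (1 - b) * sqNorm P v + b * sqNorm P w - b * (1 - b) * sqNorm P (v - w) := by
  simp only [sqNorm_eq_inner, map_add, map_sub, map_smul, inner_add_left, inner_add_right,
    inner_sub_left, inner_sub_right, real_inner_smul_left, real_inner_smul_right]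
  ring

end QuadraticForms

/-! ### Singular values -/

section SingularValues

open Module

variable {E F : Type*} [NormedAddCommGroup E] [InnerProductSpace ℝ E] [FiniteDimensional ℝ E]
  [NormedAddCommGroup F] [InnerProductSpace ℝ F] [FiniteDimensional ℝ F]

theorem LinearMap.inner_map_eigenvectorBasis (T : E →ₗ[ℝ] F) {k : ℕ} (hk : finrank ℝ E = k)
    (v : E) (i : Fin k) :
    inner ℝ (T v) (T (T.isSymmetric_adjoint_comp_self.eigenvectorBasis hk i)) =
      T.singularValues i ^ 2 *
        inner ℝ v (T.isSymmetric_adjoint_comp_self.eigenvectorBasis hk i) := by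
  rw [← LinearMap.adjoint_inner_right, ← LinearMap.comp_apply,
    T.isSymmetric_adjoint_comp_self.apply_eigenvectorBasis, T.sq_singularValues_fin hk]
  simp [real_inner_smul_right]

/-- `T` maps the orthonormal eigenbasis of `T* T` to orthogonal vectors whose lengths are the
singular values. -/
theorem LinearMap.mul_norm_le_of_le_singularValues (T : E →ₗ[ℝ] F) {σ : ℝ} (hσ : 0 ≤ σ)
    (h : ∀ i < finrank ℝ E, σ ≤ T.singularValues i) (v : E) : σ * ‖v‖ ≤ ‖T v‖ := by
  refine le_of_sq_le_sq ?_ (norm_nonneg _)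
  set b := T.isSymmetric_adjoint_comp_self.eigenvectorBasis rfl
  have hv : T v = ∑ i, inner ℝ (b i) v • T (b i) := by
    conv_lhs => rw [← b.sum_repr' v]
    simp
  rw [mul_pow, ← b.sum_sq_norm_inner_right, ← real_inner_self_eq_norm_sq (T v)]
  conv_rhs => rw [hv, inner_sum]
  rw [← hv, Finset.mul_sum]
  refine Finset.sum_le_sum fun i _ => ?_
  rw [real_inner_smul_right, T.inner_map_eigenvectorBasis rfl, real_inner_comm, Real.norm_eq_abs,
    sq_abs]
  nlinarith [h i i.2, mul_nonneg (sub_nonneg.2 (pow_le_pow_left₀ hσ (h i i.2) 2))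
    (sq_nonneg (inner ℝ v (b i)))]

/-- The normalized images of the leading eigenvectors of `T* T` are orthonormal and as numerous as
the dimension of `F`, hence a basis of `F`. Inverting `T` on them gives a bounded right inverse. -/
theorem LinearMap.exists_eq_and_mul_norm_le_of_le_singularValues (T : E →ₗ[ℝ] F) {σ : ℝ}
    (hσ : 0 < σ) (h : ∀ i < finrank ℝ F, σ ≤ T.singularValues i) (y : F) :
    ∃ v, T v = y ∧ σ * ‖v‖ ≤ ‖y‖ := by
  -- Singular values with index at least the dimension of the domain are zero by convention, so the
  -- lower bound limits the dimension of `F`.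
  have hFE : finrank ℝ F ≤ finrank ℝ E := by
    by_contra! hlt
    have := h _ hlt
    rw [T.singularValues_of_finrank_le le_rfl] at this
    linarith
  set b := T.isSymmetric_adjoint_comp_self.eigenvectorBasis rfl
  let s : Fin (finrank ℝ F) → ℝ := fun i => T.singularValues i
  let e : Fin (finrank ℝ F) → E := fun i => b (Fin.castLE hFE i)
  have hs (i) : 0 < s i := hσ.trans_le (h i i.2)
  have he : Orthonormal ℝ e := b.orthonormal.comp _ (Fin.castLE_injective hFE)
  have hTe (v : E) (i) : inner ℝ (T v) (T (e i)) = s i ^ 2 * inner ℝ v (e i) :=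
    T.inner_map_eigenvectorBasis rfl v (Fin.castLE hFE i)
  let g : Fin (finrank ℝ F) → F := fun i => (s i)⁻¹ • T (e i)
  have hg : Orthonormal ℝ g := by
    rw [orthonormal_iff_ite]
    intro i j
    simp only [g, real_inner_smul_left, real_inner_smul_right, hTe,
      orthonormal_iff_ite.1 he i j]
    have := (hs j).ne'
    split_ifs with hij
    · subst hij
      field_simp
    · simp
  have hcard : Fintype.card (Fin (finrank ℝ F)) = finrank ℝ F := by simp
  let gb : OrthonormalBasis (Fin (finrank ℝ F)) ℝ F := OrthonormalBasis.mk hg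
    (hg.linearIndependent.span_eq_top_of_card_eq_finrank' hcard).ge
  have hgb (i) : gb i = g i := by simp [gb]
  refine ⟨∑ i, ((s i)⁻¹ * inner ℝ (gb i) y) • e i, ?_, ?_⟩
  · conv_rhs => rw [← gb.sum_repr' y]
    rw [map_sum]
    refine Finset.sum_congr rfl fun i _ => ?_
    rw [map_smul, hgb, mul_comm, mul_smul]
  · refine le_of_sq_le_sq ?_ (norm_nonneg _)
    rw [mul_pow, ← real_inner_self_eq_norm_sq, he.inner_sum, ← gb.sum_sq_norm_inner_right,
      Finset.mul_sum]
    refine Finset.sum_le_sum fun i _ => ?_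
    have h1 : σ ^ 2 * (s i)⁻¹ ^ 2 ≤ 1 := by
      rw [← mul_pow]
      refine pow_le_one₀ (mul_nonneg hσ.le (inv_nonneg.2 (hs i).le)) ?_
      rw [← div_eq_mul_inv, div_le_one (hs i)]
      exact h i i.2
    simp only [conj_trivial, Real.norm_eq_abs, sq_abs]
    nlinarith [mul_nonneg (sub_nonneg.2 h1) (sq_nonneg (inner ℝ (gb i) y))]

end SingularValues

/-! ### Linear systems -/

/-- Discrete Gronwall inequality; `a + 1` replaces `a` so that no geometric sum appears. -/
theorem le_pow_mul_of_le_mul_add {r : ℕ → ℝ} {a g : ℝ} {n : ℕ} (ha : 0 ≤ a) (hg : 0 ≤ g)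
    (hr₀ : 0 ≤ r 0) (hr : ∀ k < n, r (k + 1) ≤ a * r k + g) :
    ∀ k ≤ n, r k ≤ (a + 1) ^ k * (r 0 + g) := by
  intro k
  induction k with
  | zero => intro _; simpa using hg
  | succ k ih =>
    intro hk
    have h1 : (1 : ℝ) ≤ (a + 1) ^ k := one_le_pow₀ (by linarith)
    calc r (k + 1) ≤ a * r k + g := hr k hk
      _ ≤ a * ((a + 1) ^ k * (r 0 + g)) + (a + 1) ^ k * (r 0 + g) := by
        gcongr
        · exact ih (by omega)
        · nlinarith
      _ = _ := by ring

section LinearSystems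

variable {E F : Type*} [NormedAddCommGroup E] [NormedSpace ℝ E]
  [NormedAddCommGroup F] [NormedSpace ℝ F]

/-- The trajectory of `ξ⁺ = A ξ + B ν` starting at `ξ` under the inputs `ν`. -/
noncomputable def linTraj (A : E →L[ℝ] E) (B : F →L[ℝ] E) (ξ : E) (ν : ℕ → F) : ℕ → E
  | 0 => ξ
  | k + 1 => A (linTraj A B ξ ν k) + B (ν k)

@[simp] theorem linTraj_zero (A : E →L[ℝ] E) (B : F →L[ℝ] E) (ξ : E) (ν : ℕ → F) :
    linTraj A B ξ ν 0 = ξ := rfl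

theorem linTraj_succ (A : E →L[ℝ] E) (B : F →L[ℝ] E) (ξ : E) (ν : ℕ → F) (k : ℕ) :
    linTraj A B ξ ν (k + 1) = A (linTraj A B ξ ν k) + B (ν k) := rfl

theorem linTraj_eq_pow_add_sum (A : E →L[ℝ] E) (B : F →L[ℝ] E) (ξ : E) (ν : ℕ → F) (k : ℕ) :
    linTraj A B ξ ν k = (A ^ k) ξ + ∑ j ∈ Finset.range k, (A ^ j) (B (ν (k - 1 - j))) := by
  induction k with
  | zero => simp
  | succ k ih =>
    rw [linTraj_succ, ih, Finset.sum_range_succ', map_add, map_sum, pow_succ', add_assoc]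
    simp only [mul_apply_eq_comp, pow_zero, one_apply_eq_self,
      add_tsub_cancel_right, tsub_zero]
    congr 2
    refine Finset.sum_congr rfl fun j _ => ?_
    rw [pow_succ', mul_apply_eq_comp, Nat.sub_sub, Nat.add_comm 1 j]

theorem norm_linTraj_le {A : E →L[ℝ] E} {B : F →L[ℝ] E} {a g : ℝ} (hA : ‖A‖ ≤ a) (hg : 0 ≤ g)
    (ξ : E) {ν : ℕ → F} (hν : ∀ k, ‖ν k‖ ≤ g) {n : ℕ} :
    ∀ k ≤ n, ‖linTraj A B ξ ν k‖ ≤ (a + 1) ^ k * (‖ξ‖ + ‖B‖ * g) := by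
  have ha : 0 ≤ a := (norm_nonneg A).trans hA
  refine le_pow_mul_of_le_mul_add (r := fun k => ‖linTraj A B ξ ν k‖) ha (by positivity)
    (norm_nonneg _) fun k _ => ?_
  rw [linTraj_succ]
  refine (norm_add_le _ _).trans (add_le_add ?_ ?_)
  · exact A.le_of_opNorm_le hA _
  · exact B.le_opNorm_of_le (hν k)

theorem linTraj_add (A : E →L[ℝ] E) (B : F →L[ℝ] E) (ξ : E) (ν : ℕ → F) (i j : ℕ) :
    linTraj A B ξ ν (i + j) = linTraj A B (linTraj A B ξ ν i) (fun k => ν (i + k)) j := by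
  induction j with
  | zero => rfl
  | succ j ih => rw [← add_assoc, linTraj_succ, linTraj_succ, ih]

theorem linTraj_congr (A : E →L[ℝ] E) (B : F →L[ℝ] E) (ξ : E) {ν ν' : ℕ → F} {k : ℕ}
    (h : ∀ j < k, ν j = ν' j) : linTraj A B ξ ν k = linTraj A B ξ ν' k := by
  induction k with
  | zero => rfl
  | succ k ih =>
    rw [linTraj_succ, linTraj_succ, ih fun j hj => h j (by omega), h k (by omega)]

theorem linTraj_zero_input (A : E →L[ℝ] E) (B : F →L[ℝ] E) {ν : ℕ → F} (h : ∀ j, ν j = 0)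
    (k : ℕ) : linTraj A B 0 ν k = 0 := by
  induction k with
  | zero => rfl
  | succ k ih => simp [linTraj_succ, ih, h]

end LinearSystems

namespace TrackingData

variable {n m p : ℕ} (P : TrackingData n m p)

/-! ### Consequences of the rank conditions -/

variable {P} in
theorem NonsingularDynamics.exists_mul_norm_le (h : P.NonsingularDynamics) :
    ∃ σ : ℝ, 0 < σ ∧ ∀ z v, σ * ‖v‖ ≤ ‖v - P.A z v‖ := by
  obtain ⟨σ, hσ, h⟩ := h
  refine ⟨σ, hσ, fun z v => ?_⟩
  simpa using LinearMap.mul_norm_le_of_le_singularValues _ hσ.le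
    (fun i hi => h z i (by simpa using hi)) v

variable {P} in
-- For differences of linearized steady states the first block row vanishes, so the output alone
-- controls the state. This makes the setpoint cost strongly convex in the steady state.
theorem UniqueSteadyState.exists_mul_norm_le (h : P.UniqueSteadyState) :
    ∃ σ : ℝ, 0 < σ ∧ ∀ z x u, x = P.A z x + P.B u → σ * ‖x‖ ≤ ‖P.C z x + P.D u‖ := by
  obtain ⟨σ, hσ, h⟩ := h
  refine ⟨σ, hσ, fun z x u hx => ?_⟩
  have hfr : Module.finrank ℝ (WithLp 2 (Vec n × Vec m)) = n + m := by
    rw [(WithLp.linearEquiv 2 ℝ (Vec n × Vec m)).finrank_eq]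
    simp
  have key := LinearMap.mul_norm_le_of_le_singularValues (P.blockMap z) hσ.le
    (fun i hi => h z i (by rwa [hfr] at hi)) (WithLp.toLp 2 (x, u))
  have hval : P.blockMap z (WithLp.toLp 2 (x, u)) =
      WithLp.toLp 2 (0, P.C z x + P.D u) := by
    have : P.A z x - x + P.B u = 0 := by
      nth_rw 2 [hx]
      abel
    simp [blockMap, this]
  calc σ * ‖x‖ ≤ σ * ‖WithLp.toLp 2 (x, u)‖ := by
        gcongr
        exact WithLp.norm_fst_le _ (WithLp.toLp 2 (x, u))
    _ ≤ _ := key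
    _ = _ := by rw [hval, WithLp.prod_norm_eq_of_L2]; simp

variable {P} in
theorem UniformlyControllable.exists_sum_eq (h : P.UniformlyControllable) :
    ∃ σ : ℝ, 0 < σ ∧ ∀ z v, ∃ w : Fin n → Vec m,
      ∑ k : Fin n, (P.A z ^ (k : ℕ)) (P.B (w k)) = v ∧ ∀ k, σ * ‖w k‖ ≤ ‖v‖ := by
  obtain ⟨σ, hσ, h⟩ := h
  refine ⟨σ, hσ, fun z v => ?_⟩
  obtain ⟨w, hw, hle⟩ := LinearMap.exists_eq_and_mul_norm_le_of_le_singularValues (P.ctrbMap z) hσ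
    (fun i hi => h z i (by simpa using hi)) v
  refine ⟨fun k => w k, ?_, fun k => le_trans ?_ hle⟩
  · rw [← hw]
    change _ = (∑ k : Fin n, (P.A z ^ (k : ℕ)) ∘L P.B ∘L
      (PiLp.proj 2 (fun _ : Fin n => Vec m) k :
        PiLp 2 (fun _ : Fin n => Vec m) →L[ℝ] Vec m)) w
    rw [sum_apply]
    rfl
  · gcongr
    exact PiLp.norm_apply_le w k

variable {P} in
-- The bounded right inverse of the controllability matrix cancels the free response after n steps.
-- `G` depends only on the bound `a`, so it is uniform in the linearization point.
theorem UniformlyControllable.exists_steering (h : P.UniformlyControllable) (a : ℝ) :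
    ∃ G : ℝ, 0 < G ∧ ∀ z, ‖P.A z‖ ≤ a → ∀ ξ, ∃ ν : ℕ → Vec m, (∀ k, ‖ν k‖ ≤ G * ‖ξ‖) ∧
      (∀ k, ‖linTraj (P.A z) P.B ξ ν k‖ ≤ G * ‖ξ‖) ∧
      ∀ k ≥ n, linTraj (P.A z) P.B ξ ν k = 0 := by
  obtain ⟨σ, hσ, h⟩ := h.exists_sum_eq
  rcases lt_or_ge a 0 with ha | ha
  · exact ⟨1, one_pos, fun z hz => absurd ((norm_nonneg _).trans hz) (not_le.2 ha)⟩
  have h1 : (1 : ℝ) ≤ (a + 1) ^ n := one_le_pow₀ (by linarith)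
  set g : ℝ := (a + 1) ^ n / σ with hg
  refine ⟨g + (a + 1) ^ n * (1 + ‖P.B‖ * g), by positivity, fun z hz ξ => ?_⟩
  obtain ⟨w, hw, hle⟩ := h z (-(P.A z ^ n) ξ)
  -- The order is reversed because the power j of `A` acts on the input at time n - 1 - j; zero
  -- inputs afterwards keep the origin.
  let ν : ℕ → Vec m := fun k => if hk : k < n then w ⟨n - 1 - k, by omega⟩ else 0
  have hpow : ‖(P.A z ^ n) ξ‖ ≤ (a + 1) ^ n * ‖ξ‖ := by
    refine (P.A z ^ n).le_of_opNorm_le ?_ _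
    rcases Nat.eq_zero_or_pos n with rfl | hn
    · simp
    · refine (norm_pow_le' _ hn).trans ?_
      gcongr
      linarith
  have hν (k) : ‖ν k‖ ≤ g * ‖ξ‖ := by
    simp only [ν]
    split_ifs with hk
    · have := (hle ⟨n - 1 - k, by omega⟩).trans (by simpa using hpow)
      rw [hg, div_mul_eq_mul_div, le_div_iff₀ hσ, mul_comm]
      exact this
    · rw [norm_zero]
      positivity
  have hend : linTraj (P.A z) P.B ξ ν n = 0 := by
    rw [linTraj_eq_pow_add_sum, ← Fin.sum_univ_eq_sum_range
      (fun j => (P.A z ^ j) (P.B (ν (n - 1 - j))))]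
    have : ∀ j : Fin n, ν (n - 1 - j) = w j := fun j => by
      have hj := j.2
      simp only [ν, dif_pos (show n - 1 - (j : ℕ) < n by omega)]
      congr 1
      ext
      simp only
      omega
    simp only [this, hw]
    simp
  have hzero : ∀ k ≥ n, linTraj (P.A z) P.B ξ ν k = 0 := by
    intro k hk
    obtain ⟨j, rfl⟩ := Nat.exists_eq_add_of_le hk
    rw [linTraj_add, hend]
    exact linTraj_zero_input _ _ (fun j => by simp [ν]) j
  refine ⟨ν, fun k => ?_, fun k => ?_, hzero⟩
  · refine (hν k).trans ?_
    gcongr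
    simp only [le_add_iff_nonneg_right]
    positivity
  · rcases le_total n k with hk | hk
    · rw [hzero k hk, norm_zero]
      positivity
    · refine (norm_linTraj_le hz (by positivity) ξ hν k hk).trans ?_
      calc (a + 1) ^ k * (‖ξ‖ + ‖P.B‖ * (g * ‖ξ‖))
          ≤ (a + 1) ^ n * (‖ξ‖ + ‖P.B‖ * (g * ‖ξ‖)) := by
            gcongr
            linarith
        _ ≤ (g + (a + 1) ^ n * (1 + ‖P.B‖ * g)) * ‖ξ‖ := by
            have : 0 ≤ g * ‖ξ‖ := by positivity
            nlinarith

/-! ### Steady states of the linearized dynamics -/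

theorem mem_ZsLin_iff {z x : Vec n} {u : Vec m} :
    (x, u) ∈ P.ZsLin z ↔ u ∈ P.Us ∧ x = P.fLin z x u := Iff.rfl

theorem exists_mem_ZsLin {σ : ℝ} (hσ : 0 < σ) (h : ∀ z v, σ * ‖v‖ ≤ ‖v - P.A z v‖) (z : Vec n)
    {u : Vec m} (hu : u ∈ P.Us) : ∃ x, (x, u) ∈ P.ZsLin z := by
  have hinj : Function.Injective ((1 - P.A z : Vec n →L[ℝ] Vec n) : Vec n →ₗ[ℝ] Vec n) := by
    rw [← LinearMap.ker_eq_bot, LinearMap.ker_eq_bot']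
    intro v hv
    have h1 : v - P.A z v = 0 := by simpa using hv
    have h2 := h z v
    rw [h1, norm_zero] at h2
    exact norm_le_zero_iff.1 (by nlinarith [norm_nonneg v])
  obtain ⟨x, hx⟩ := LinearMap.injective_iff_surjective.1 hinj (P.B u + P.e z)
  have hx' : x - P.A z x = P.B u + P.e z := by simpa using hx
  refine ⟨x, hu, ?_⟩
  simp only [fLin]
  rw [add_assoc, ← hx']
  abel

/-- A linearization is exact at its base point. -/
theorem mem_Zs_iff_mem_ZsLin_self {x : Vec n} {u : Vec m} :
    (x, u) ∈ P.Zs ↔ (x, u) ∈ P.ZsLin x := by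
  have : P.fLin x x u = P.f x u := by
    simp only [f, fLin, e]
    abel
  rw [mem_ZsLin_iff, this]
  rfl

theorem hLin_self (x : Vec n) (u : Vec m) : P.hLin x x u = P.h x u := by
  simp only [hLin, h, r]
  abel

theorem convexCombination_mem_ZsLin (hU : Convex ℝ P.Us) {z x x' : Vec n} {u u' : Vec m}
    (h : (x, u) ∈ P.ZsLin z) (h' : (x', u') ∈ P.ZsLin z) {b : ℝ} (hb₀ : 0 ≤ b) (hb₁ : b ≤ 1) :
    ((1 - b) • x + b • x', (1 - b) • u + b • u') ∈ P.ZsLin z := by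
  rw [mem_ZsLin_iff] at h h' ⊢
  refine ⟨hU h.1 h'.1 (by linarith) hb₀ (by ring), ?_⟩
  nth_rw 1 [h.2, h'.2]
  simp only [fLin, map_add, map_smul]
  module

theorem hLin_convexCombination (z x x' : Vec n) (u u' : Vec m) (b : ℝ) :
    P.hLin z ((1 - b) • x + b • x') ((1 - b) • u + b • u') =
      (1 - b) • P.hLin z x u + b • P.hLin z x' u' := by
  simp only [hLin, map_add, map_smul]
  module

theorem fLin_add {z x : Vec n} {u : Vec m} (h : x = P.fLin z x u) (ξ : Vec n) (ν : Vec m) :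
    P.fLin z (x + ξ) (u + ν) = x + (P.A z ξ + P.B ν) := by
  conv_rhs => rw [h]
  simp only [fLin, map_add]
  abel

/-! ### Candidates in error coordinates -/

/-- The tracking part of the cost of steering `z` to the steady state with state component `xs`,
in terms of the deviation `ν` of the inputs from their steady state. -/
noncomputable def trackCost (z xs : Vec n) (ν : ℕ → Vec m) : ℝ :=
  ∑ k ∈ Finset.range P.N,
    (sqNorm P.Q (linTraj (P.A z) P.B (z - xs) ν k) + sqNorm P.R (ν k))

/-- Subtracting the steady state removes the offset of the affine model. Together with
`IsFeasiblePoint.exists_input`, this reduces candidates to a steady state and an input deviation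
driving a linear system to the origin at time N. -/
theorem exists_isFeasiblePoint {z xs : Vec n} {us : Vec m} (hs : (xs, us) ∈ P.ZsLin z)
    {ν : ℕ → Vec m} (hU : ∀ k < P.N, us + ν k ∈ P.U)
    (hN : linTraj (P.A z) P.B (z - xs) ν P.N = 0) :
    ∃ c, P.IsFeasiblePoint z c ∧ ∀ S, P.cost S c =
      P.trackCost z xs ν + sqNorm S (P.hLin z xs us - P.yr) := by
  refine ⟨⟨fun k => xs + linTraj (P.A z) P.B (z - xs) ν k, fun k => us + ν k, xs, us,
    P.hLin z xs us⟩, ⟨fun k => ?_, by simp, ?_, fun k => hU k k.2, hs, rfl⟩, fun S => ?_⟩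
  · simp only [Fin.val_succ, Fin.val_castSucc, linTraj_succ]
    rw [P.fLin_add hs.2]
  · simp [hN]
  · simp only [cost, trackCost, Fin.val_castSucc, add_sub_cancel_left]
    rw [Fin.sum_univ_eq_sum_range (fun k => sqNorm P.Q (linTraj (P.A z) P.B (z - xs) ν k) +
      sqNorm P.R (ν k))]

variable {P} in
theorem IsFeasiblePoint.exists_input {z : Vec n} {c : Candidate n m p P.N}
    (h : P.IsFeasiblePoint z c) :
    ∃ ν : ℕ → Vec m, (∀ k : Fin P.N, c.u k = c.us + ν k) ∧ (∀ k < P.N, c.us + ν k ∈ P.U) ∧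
      linTraj (P.A z) P.B (z - c.xs) ν P.N = 0 ∧ ∀ S, P.cost S c =
        P.trackCost z c.xs ν + sqNorm S (P.hLin z c.xs c.us - P.yr) := by
  let ν : ℕ → Vec m := fun k => if hk : k < P.N then c.u ⟨k, hk⟩ - c.us else 0
  have hν (k : Fin P.N) : c.u k = c.us + ν k := by simp [ν]
  have hx : ∀ k (hk : k < P.N + 1),
      c.x ⟨k, hk⟩ = c.xs + linTraj (P.A z) P.B (z - c.xs) ν k := by
    intro k
    induction k with
    | zero => intro hk; simpa using h.init
    | succ k ih =>
      intro hk
      have h1 := h.dyn ⟨k, by omega⟩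
      simp only [Fin.succ_mk, Fin.castSucc_mk] at h1
      rw [h1, ih, hν, P.fLin_add h.equil.2, linTraj_succ]
  have hU (k) (hk : k < P.N) : c.us + ν k ∈ P.U := by
    rw [← hν ⟨k, hk⟩]
    exact h.input _
  refine ⟨ν, hν, hU, ?_, fun S => ?_⟩
  · have := hx P.N (by omega)
    rw [show (⟨P.N, by omega⟩ : Fin (P.N + 1)) = Fin.last P.N from rfl, h.terminal] at this
    simpa using this
  · rw [cost, trackCost, ← Fin.sum_univ_eq_sum_range (fun k =>
      sqNorm P.Q (linTraj (P.A z) P.B (z - c.xs) ν k) + sqNorm P.R (ν k)), h.output]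
    congr 1
    refine Finset.sum_congr rfl fun k _ => ?_
    have h1 := hx k (by omega)
    rw [show (⟨k, by omega⟩ : Fin (P.N + 1)) = k.castSucc from rfl] at h1
    rw [h1, hν]
    simp

end TrackingData

/-! ### Quantitative smoothness on compact sets -/

theorem ContDiff.exists_bounds_on_compact {E F : Type*} [NormedAddCommGroup E] [NormedSpace ℝ E]
    [NormedAddCommGroup F] [NormedSpace ℝ F] {f : E → F} (hf : ContDiff ℝ 2 f) {X : Set E}
    (hX : IsCompact X) (hc : Convex ℝ X) :
    ∃ L : ℝ, 0 < L ∧ (∀ z ∈ X, ‖f z‖ ≤ L) ∧ (∀ z ∈ X, ‖fderiv ℝ f z‖ ≤ L) ∧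
      (∀ z ∈ X, ∀ x ∈ X, ‖fderiv ℝ f x - fderiv ℝ f z‖ ≤ L * ‖x - z‖) ∧
      ∀ z ∈ X, ∀ x ∈ X, ‖f x - f z - fderiv ℝ f z (x - z)‖ ≤ L * ‖x - z‖ ^ 2 := by
  have hf' : ContDiff ℝ 1 (fderiv ℝ f) := hf.fderiv_right (by norm_num)
  obtain ⟨L₁, h₁⟩ := hX.exists_bound_of_continuousOn hf.continuous.continuousOn
  obtain ⟨L₂, h₂⟩ := hX.exists_bound_of_continuousOn hf'.continuous.continuousOn
  obtain ⟨L₃, h₃⟩ := hf'.contDiffOn.exists_lipschitzOnWith one_ne_zero hc hX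
  have hlip : ∀ z ∈ X, ∀ x ∈ X, ‖fderiv ℝ f x - fderiv ℝ f z‖ ≤ L₃ * ‖x - z‖ := fun z hz x hx => by
    simpa [dist_eq_norm] using h₃.dist_le_mul x hx z hz
  have hle₁ : L₁ ≤ max (max L₁ L₂) (max L₃ 1) := by simp
  have hle₂ : L₂ ≤ max (max L₁ L₂) (max L₃ 1) := by simp
  have hle₃ : (L₃ : ℝ) ≤ max (max L₁ L₂) (max L₃ 1) := by simp
  refine ⟨max (max L₁ L₂) (max L₃ 1), by positivity, fun z hz => (h₁ z hz).trans hle₁,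
    fun z hz => (h₂ z hz).trans hle₂, fun z hz x hx => (hlip z hz x hx).trans (by gcongr),
    fun z hz x hx => ?_⟩
  have hseg := hc.segment_subset hz hx
  -- Restricting to the segment bounds the variation of the derivative by a multiple of ‖x - z‖,
  -- whence a quadratic remainder.
  have := Convex.norm_image_sub_le_of_norm_fderiv_le' (f := f) (φ := fderiv ℝ f z)
    (s := segment ℝ z x) (C := L₃ * ‖x - z‖) (𝕜 := ℝ)
    (fun y _ => (hf.differentiable (by norm_num)).differentiableAt)
    (fun y hy => (hlip z hz y (hseg hy)).trans (by gcongr; exact norm_sub_le_of_mem_segment hy))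
    (convex_segment z x) (left_mem_segment ℝ z x) (right_mem_segment ℝ z x)
  calc _ ≤ L₃ * ‖x - z‖ * ‖x - z‖ := this
    _ = L₃ * ‖x - z‖ ^ 2 := by ring
    _ ≤ _ := by gcongr

namespace TrackingData

variable {n m p : ℕ} (P : TrackingData n m p)

/-- Bounds for the vector fields on `X`, all with the constant `L`. -/
structure RegularOn (X : Set (Vec n)) (L : ℝ) : Prop where
  pos : 0 < L
  norm_h₀_le : ∀ z ∈ X, ‖P.h₀ z‖ ≤ L
  norm_A_le : ∀ z ∈ X, ‖P.A z‖ ≤ L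
  norm_C_le : ∀ z ∈ X, ‖P.C z‖ ≤ L
  norm_A_sub_le : ∀ z ∈ X, ∀ x ∈ X, ‖P.A x - P.A z‖ ≤ L * ‖x - z‖
  norm_f₀_sub_le : ∀ z ∈ X, ∀ x ∈ X, ‖P.f₀ x - P.f₀ z - P.A z (x - z)‖ ≤ L * ‖x - z‖ ^ 2
  norm_h₀_sub_le : ∀ z ∈ X, ∀ x ∈ X, ‖P.h₀ x - P.h₀ z - P.C z (x - z)‖ ≤ L * ‖x - z‖ ^ 2

variable {P}

theorem Smooth.exists_regularOn (h : P.Smooth) {X : Set (Vec n)} (hX : IsCompact X)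
    (hc : Convex ℝ X) : ∃ L, P.RegularOn X L := by
  obtain ⟨L, hL, -, h₂, h₃, h₄⟩ := h.1.exists_bounds_on_compact hX hc
  obtain ⟨L', -, h₁', h₂', -, h₄'⟩ := h.2.exists_bounds_on_compact hX hc
  have hle : L ≤ max L L' := le_max_left _ _
  have hle' : L' ≤ max L L' := le_max_right _ _
  exact ⟨max L L', lt_max_of_lt_left hL, fun z hz => (h₁' z hz).trans hle',
    fun z hz => (h₂ z hz).trans hle, fun z hz => (h₂' z hz).trans hle',
    fun z hz x hx => (h₃ z hz x hx).trans (by gcongr),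
    fun z hz x hx => (h₄ z hz x hx).trans (by gcongr),
    fun z hz x hx => (h₄' z hz x hx).trans (by gcongr)⟩

theorem Standing.exists_margin (h : P.Standing) :
    ∃ ε : ℝ, 0 < ε ∧ ∀ u ∈ P.Us, ∀ v : Vec m, ‖v‖ ≤ ε → u + v ∈ P.U := by
  obtain ⟨ε, hε, hsub⟩ := h.compact_Us.exists_cthickening_subset_open isOpen_interior h.Us_subset
  refine ⟨ε, hε, fun u hu v hv => interior_subset (hsub ?_)⟩
  exact Metric.mem_cthickening_of_dist_le _ u _ _ hu (by simpa using hv)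

/-! ### Changing the linearization point -/

variable (P) in
theorem fLin_sub_fLin (z z' x : Vec n) (u : Vec m) :
    P.fLin z' x u - P.fLin z x u =
      (P.f₀ x - P.f₀ z - P.A z (x - z)) - (P.f₀ x - P.f₀ z' - P.A z' (x - z')) := by
  simp only [fLin, e, map_sub]
  abel

variable (P) in
theorem hLin_sub_hLin (z z' x x' : Vec n) (u : Vec m) :
    P.hLin z' x' u - P.hLin z x u = P.C z' (x' - x) +
      ((P.h₀ x - P.h₀ z - P.C z (x - z)) - (P.h₀ x - P.h₀ z' - P.C z' (x - z'))) := by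
  simp only [hLin, r, map_sub]
  abel

/-- With `u` kept, the two affine models differ at `x` by two Taylor remainders, so `x` is a steady
state of the new model up to a quadratic error. The uniform inverse of I - A turns this residual
into a state error, and the output follows. -/
theorem NonsingularDynamics.exists_transfer (h : P.NonsingularDynamics) {X : Set (Vec n)} {L : ℝ}
    (hL : P.RegularOn X L) :
    ∃ c : ℝ, 0 < c ∧ ∀ z ∈ X, ∀ z' ∈ X, ∀ x ∈ X, ∀ u, (x, u) ∈ P.ZsLin z →
      ∃ x', (x', u) ∈ P.ZsLin z' ∧ ‖x' - x‖ ≤ c * (‖x - z‖ ^ 2 + ‖x - z'‖ ^ 2) ∧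
        ‖P.hLin z' x' u - P.hLin z x u‖ ≤ c * (‖x - z‖ ^ 2 + ‖x - z'‖ ^ 2) := by
  obtain ⟨σ, hσ, h⟩ := h.exists_mul_norm_le
  have hL₀ := hL.pos
  refine ⟨L / σ + (L * (L / σ) + L), by positivity, fun z hz z' hz' x hx u hu => ?_⟩
  obtain ⟨x', hx'⟩ := P.exists_mem_ZsLin hσ h z' hu.1
  set q := ‖x - z‖ ^ 2 + ‖x - z'‖ ^ 2 with hq
  have hq₀ : 0 ≤ q := by positivity
  have h1 : ‖P.fLin z' x u - P.fLin z x u‖ ≤ L * q := by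
    rw [fLin_sub_fLin, hq, mul_add]
    exact (norm_sub_le _ _).trans
      (add_le_add (hL.norm_f₀_sub_le z hz x hx) (hL.norm_f₀_sub_le z' hz' x hx))
  have h2 : (x' - x) - P.A z' (x' - x) = P.fLin z' x u - P.fLin z x u := by
    rw [← ((P.mem_ZsLin_iff).1 hu).2]
    nth_rw 1 [((P.mem_ZsLin_iff).1 hx').2]
    simp only [fLin, map_sub]
    abel
  have h3 : ‖x' - x‖ ≤ L / σ * q := by
    rw [div_mul_eq_mul_div, le_div_iff₀ hσ, mul_comm]
    exact (h z' _).trans (by rwa [h2])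
  refine ⟨x', hx', h3.trans ?_, ?_⟩
  · exact mul_le_mul_of_nonneg_right (le_add_of_nonneg_right (by positivity)) hq₀
  · rw [hLin_sub_hLin]
    calc _ ≤ L * (L / σ * q) + (L * ‖x - z‖ ^ 2 + L * ‖x - z'‖ ^ 2) := by
          refine (norm_add_le _ _).trans (add_le_add ?_ ((norm_sub_le _ _).trans
            (add_le_add (hL.norm_h₀_sub_le z hz x hx) (hL.norm_h₀_sub_le z' hz' x hx))))
          exact ((P.C z').le_of_opNorm_le (hL.norm_C_le z' hz') _).trans (by gcongr)
      _ = (L * (L / σ) + L) * q := by rw [hq]; ring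
      _ ≤ _ := by
        exact mul_le_mul_of_nonneg_right (le_add_of_nonneg_left (by positivity)) hq₀

theorem Standing.exists_norm_output_le (h : P.Standing) {X : Set (Vec n)} {L : ℝ}
    (hL : P.RegularOn X L) (hX : Bornology.IsBounded X) :
    ∃ Y : ℝ, 0 < Y ∧ ∀ z ∈ X, ∀ x ∈ X, ∀ u ∈ P.Us, ‖P.hLin z x u - P.yr‖ ≤ Y := by
  obtain ⟨b, hb⟩ := h.compact_Us.isBounded.exists_norm_le
  obtain ⟨ρ, hρ⟩ := hX.exists_norm_le
  have hL₀ := hL.pos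
  refine ⟨max 1 (L * (ρ + ρ) + L + ‖P.D‖ * b + ‖P.yr‖), by positivity,
    fun z hz x hx u hu => le_max_of_le_right ?_⟩
  have : P.hLin z x u = P.C z (x - z) + P.h₀ z + P.D u := by
    simp only [hLin, r, map_sub]
    abel
  rw [this]
  refine (norm_sub_le _ _).trans (add_le_add ((norm_add_le _ _).trans (add_le_add
    ((norm_add_le _ _).trans (add_le_add ?_ (hL.norm_h₀_le z hz)))
    ((P.D).le_opNorm_of_le (hb u hu)))) le_rfl)
  refine ((P.C z).le_of_opNorm_le (hL.norm_C_le z hz) _).trans ?_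
  gcongr
  exact (norm_sub_le _ _).trans (add_le_add (hρ x hx) (hρ z hz))

/-! ### Existence of optimal solutions -/

variable (P) in
theorem isClosed_ZsLin (h : P.Standing) (z : Vec n) : IsClosed (P.ZsLin z) := by
  have : P.ZsLin z = {w | w.2 ∈ P.Us} ∩ {w | w.1 = P.fLin z w.1 w.2} := rfl
  rw [this]
  refine (h.compact_Us.isClosed.preimage continuous_snd).inter (isClosed_eq continuous_fst ?_)
  unfold fLin
  fun_prop

/-- The inputs and the steady state determine the trajectory, so this is a continuous cost on a
closed subset of the compact set K × U^N. -/
theorem exists_isOptimal (h : P.Standing) {K : Set (Vec n × Vec m)}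
    (hK : P.CompactSteadyStates K) (S : Matrix (Fin p) (Fin p) ℝ) {z : Vec n}
    (hz : P.Feasible z) : ∃ c, P.IsOptimal S z c := by
  let ν : (Vec n × Vec m) × (Fin P.N → Vec m) → ℕ → Vec m := fun w k => if hk : k < P.N then w.2 ⟨k, hk⟩ - w.1.2 else 0
  have hν (k) : Continuous fun w => ν w k := by
    by_cases hk : k < P.N
    · simp only [ν, dif_pos hk]
      fun_prop
    · simp only [ν, dif_neg hk]
      fun_prop
  have hν' (w) (k : Fin P.N) : w.1.2 + ν w k = w.2 k := by simp [ν]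
  have htr (k) : Continuous fun w : (Vec n × Vec m) × (Fin P.N → Vec m) => linTraj (P.A z) P.B (z - w.1.1) (ν w) k := by
    induction k with
    | zero => simp only [linTraj_zero]; fun_prop
    | succ k ih => simp only [linTraj_succ]; fun_prop
  let J : (Vec n × Vec m) × (Fin P.N → Vec m) → ℝ := fun w =>
    P.trackCost z w.1.1 (ν w) + sqNorm S (P.hLin z w.1.1 w.1.2 - P.yr)
  have hJ : Continuous J := by
    refine Continuous.add (continuous_finsetSum _ fun k _ => ?_) ((continuous_sqNorm S).comp ?_)
    · exact ((continuous_sqNorm _).comp (htr k)).add ((continuous_sqNorm _).comp (hν k))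
    · unfold hLin
      fun_prop
  let s : Set ((Vec n × Vec m) × (Fin P.N → Vec m)) := (K ×ˢ Set.univ.pi fun _ => P.U) ∩
    ({w | w.1 ∈ P.ZsLin z} ∩ {w | linTraj (P.A z) P.B (z - w.1.1) (ν w) P.N = 0})
  have hs : IsCompact s :=
    (hK.1.prod (isCompact_univ_pi fun _ => h.compact_U)).inter_right
      (((P.isClosed_ZsLin h z).preimage continuous_fst).inter
        (isClosed_eq (htr P.N) continuous_const))
  have hmem : ∀ c, P.IsFeasiblePoint z c →
      ∃ w ∈ s, P.cost S c = J w := by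
    intro c hc
    obtain ⟨ν', hu, hU, hN, hcost⟩ := hc.exists_input
    have heq : ∀ k < P.N, ν ((c.xs, c.us), c.u) k = ν' k := fun k hk => by
      simp [ν, hk, hu]
    have heq' : ∀ k ≤ P.N, linTraj (P.A z) P.B (z - c.xs) (ν ((c.xs, c.us), c.u)) k =
        linTraj (P.A z) P.B (z - c.xs) ν' k :=
      fun k hk => linTraj_congr _ _ _ fun j hj => heq j (by omega)
    refine ⟨((c.xs, c.us), c.u), ⟨⟨hK.2.2 z hc.equil, fun k _ => hc.input k⟩, hc.equil,
      (heq' _ le_rfl).trans hN⟩, ?_⟩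
    rw [hcost]
    simp only [J, trackCost]
    congr 1
    refine Finset.sum_congr rfl fun k hk => ?_
    rw [Finset.mem_range] at hk
    rw [heq k hk, heq' k hk.le]
  obtain ⟨c₀, hc₀⟩ := hz
  obtain ⟨w₀, hw₀, -⟩ := hmem c₀ hc₀
  obtain ⟨w, hw, hmin⟩ := hs.exists_isMinOn ⟨w₀, hw₀⟩ hJ.continuousOn
  obtain ⟨c, hc, hcost⟩ := P.exists_isFeasiblePoint (z := z) (xs := w.1.1) (us := w.1.2) hw.2.1
    (ν := ν w) (fun k hk => by
      rw [hν' w ⟨k, hk⟩]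
      exact hw.1.2 ⟨k, hk⟩ trivial) hw.2.2
  refine ⟨c, hc, fun c' hc' => ?_⟩
  obtain ⟨w', hw', hcost'⟩ := hmem c' hc'
  rw [hcost, hcost']
  exact hmin hw'

/-! ### Upper and lower bounds of the tracking cost -/

theorem Standing.exists_weight_bounds (h : P.Standing) :
    ∃ q M : ℝ, 0 < q ∧ 0 < M ∧ (∀ v, q * ‖v‖ ^ 2 ≤ sqNorm P.Q v) ∧
      (∀ v, q * ‖v‖ ^ 2 ≤ sqNorm P.R v) ∧ ‖Matrix.toEuclideanCLM (𝕜 := ℝ) P.Q‖ ≤ M ∧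
      ‖Matrix.toEuclideanCLM (𝕜 := ℝ) P.R‖ ≤ M := by
  obtain ⟨q, hq, h1⟩ := exists_pos_mul_norm_sq_le_sqNorm h.posDef_Q
  obtain ⟨q', hq', h2⟩ := exists_pos_mul_norm_sq_le_sqNorm h.posDef_R
  refine ⟨min q q', max (max ‖Matrix.toEuclideanCLM (𝕜 := ℝ) P.Q‖
    ‖Matrix.toEuclideanCLM (𝕜 := ℝ) P.R‖) 1, lt_min hq hq', by positivity,
    fun v => le_trans ?_ (h1 v), fun v => le_trans ?_ (h2 v), by simp, by simp⟩
  · gcongr; exact min_le_left _ _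
  · gcongr; exact min_le_right _ _

theorem Standing.stage_nonneg (h : P.Standing) (v : Vec n) (w : Vec m) :
    0 ≤ sqNorm P.Q v + sqNorm P.R w :=
  add_nonneg (sqNorm_nonneg h.posDef_Q v) (sqNorm_nonneg h.posDef_R w)

theorem Standing.trackCost_nonneg (h : P.Standing) (z xs : Vec n) (ν : ℕ → Vec m) :
    0 ≤ P.trackCost z xs ν := Finset.sum_nonneg fun _ _ => h.stage_nonneg _ _

theorem Standing.mul_norm_sq_le_trackCost (h : P.Standing) {q : ℝ}
    (hq : ∀ v, q * ‖v‖ ^ 2 ≤ sqNorm P.Q v) (z xs : Vec n) (ν : ℕ → Vec m) {k : ℕ}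
    (hk : k < P.N) :
    q * ‖linTraj (P.A z) P.B (z - xs) ν k‖ ^ 2 ≤ P.trackCost z xs ν := by
  refine ((hq _).trans (le_add_of_nonneg_right (sqNorm_nonneg h.posDef_R (ν k)))).trans ?_
  exact Finset.single_le_sum (f := fun k => sqNorm P.Q (linTraj (P.A z) P.B (z - xs) ν k) +
    sqNorm P.R (ν k)) (fun _ _ => h.stage_nonneg _ _) (Finset.mem_range.2 hk)

/-- Steering inputs and states are proportional to ‖z - xs‖: the cost is quadratic, and within `ε /
G` the inputs stay in the margin of `Us` inside `U`. -/
theorem exists_steering_candidate (h : P.Standing) (h₃ : P.UniformlyControllable) (hN : n ≤ P.N)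
    {X : Set (Vec n)} {L : ℝ} (hL : P.RegularOn X L) :
    ∃ δ Γ : ℝ, 0 < δ ∧ 0 < Γ ∧ ∀ z ∈ X, ∀ xs us, (xs, us) ∈ P.ZsLin z → ‖z - xs‖ ≤ δ →
      ∃ c, P.IsFeasiblePoint z c ∧ ∀ S, P.cost S c ≤
        Γ * ‖z - xs‖ ^ 2 + sqNorm S (P.hLin z xs us - P.yr) := by
  obtain ⟨q, M, hq, hM, -, -, hQ, hR⟩ := h.exists_weight_bounds
  obtain ⟨ε, hε, hU⟩ := h.exists_margin
  obtain ⟨G, hG, hst⟩ := h₃.exists_steering L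
  refine ⟨ε / G, P.N * (M * G ^ 2 + M * G ^ 2) + 1, by positivity, by positivity,
    fun z hz xs us hs hle => ?_⟩
  obtain ⟨ν, hν, hξ, hend⟩ := hst z (hL.norm_A_le z hz) (z - xs)
  rw [le_div_iff₀ hG, mul_comm] at hle
  obtain ⟨c, hc, hcost⟩ := P.exists_isFeasiblePoint hs (ν := ν)
    (fun k _ => hU us hs.1 _ ((hν k).trans hle)) (hend _ hN)
  refine ⟨c, hc, fun S => ?_⟩
  rw [hcost]
  gcongr
  calc P.trackCost z xs ν
      ≤ ∑ k ∈ Finset.range P.N, (M * (G * ‖z - xs‖) ^ 2 + M * (G * ‖z - xs‖) ^ 2) := by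
        refine Finset.sum_le_sum fun k _ => add_le_add ((sqNorm_le _ hQ _).trans ?_)
          ((sqNorm_le _ hR _).trans ?_)
        · gcongr; exact hξ k
        · gcongr; exact hν k
    _ = P.N * (M * G ^ 2 + M * G ^ 2) * ‖z - xs‖ ^ 2 := by
        rw [Finset.sum_const, Finset.card_range, nsmul_eq_mul]
        ring
    _ ≤ _ := by nlinarith [sq_nonneg ‖z - xs‖]

end TrackingData

/-! ### Perturbation of trajectories and of quadratic costs -/

theorem mul_sqrt_le_of_le_div_sq {g T e : ℝ} (hg : 0 < g) (he : 0 ≤ e) (hT : T ≤ (e / g) ^ 2) :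
    g * √T ≤ e := by
  rw [mul_comm, ← le_div_iff₀ hg]
  exact Real.sqrt_le_iff.2 ⟨by positivity, hT⟩

theorem le_sqrt_of_le_one {T : ℝ} (h₀ : 0 ≤ T) (h₁ : T ≤ 1) : T ≤ √T :=
  Real.le_sqrt_of_sq_le (by nlinarith)

/-- The difference obeys the dynamics `A'` forced by `(A' - A) ξ`, so Gronwall applies. -/
theorem norm_linTraj_sub_linTraj_le {E F : Type*} [NormedAddCommGroup E] [NormedSpace ℝ E]
    [NormedAddCommGroup F] [NormedSpace ℝ F] {A A' : E →L[ℝ] E} (B : F →L[ℝ] E) {a l γ : ℝ}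
    (hA' : ‖A'‖ ≤ a) (hl : ‖A' - A‖ ≤ l) (hγ : 0 ≤ γ) (ξ ξ' : E) (ν : ℕ → F) {k : ℕ}
    (hξ : ∀ j < k, ‖linTraj A B ξ ν j‖ ≤ γ) :
    ‖linTraj A' B ξ' ν k - linTraj A B ξ ν k‖ ≤ (a + 1) ^ k * (‖ξ' - ξ‖ + l * γ) := by
  have ha : 0 ≤ a := (norm_nonneg _).trans hA'
  have hl₀ : 0 ≤ l := (norm_nonneg _).trans hl
  refine le_pow_mul_of_le_mul_add (r := fun k => ‖linTraj A' B ξ' ν k - linTraj A B ξ ν k‖)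
    ha (by positivity) (norm_nonneg _) (fun j hj => ?_) k le_rfl
  have : linTraj A' B ξ' ν (j + 1) - linTraj A B ξ ν (j + 1) =
      A' (linTraj A' B ξ' ν j - linTraj A B ξ ν j) + (A' - A) (linTraj A B ξ ν j) := by
    simp only [linTraj_succ, map_sub, sub_apply]
    abel
  rw [this]
  refine (norm_add_le _ _).trans (add_le_add (A'.le_of_opNorm_le hA' _) ?_)
  exact ((A' - A).le_of_opNorm_le hl _).trans (by gcongr; exact hξ j hj)

theorem sqNorm_sub_le_of_norm_sub_le {d : ℕ} (P : Matrix (Fin d) (Fin d) ℝ) {M Y e : ℝ}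
    (hM : ‖Matrix.toEuclideanCLM (𝕜 := ℝ) P‖ ≤ M) {y y' r : Vec d} (hy : ‖y - r‖ ≤ Y)
    (hd : ‖y' - y‖ ≤ e) :
    sqNorm P (y' - r) ≤ sqNorm P (y - r) + M * (2 * Y * e + e ^ 2) := by
  have hM₀ : 0 ≤ M := (norm_nonneg _).trans hM
  have hY : 0 ≤ Y := (norm_nonneg _).trans hy
  have h1 := sqNorm_add_le P hM (y - r) (y' - y)
  rw [show y - r + (y' - y) = y' - r by abel] at h1
  exact h1.trans (by gcongr)

theorem sum_sqNorm_le_of_norm_sub_le {d d' : ℕ} (Q : Matrix (Fin d) (Fin d) ℝ)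
    (R : Matrix (Fin d') (Fin d') ℝ) {M γ e : ℝ} (hM : ‖Matrix.toEuclideanCLM (𝕜 := ℝ) Q‖ ≤ M)
    {ξ ξ' : ℕ → Vec d} {ν : ℕ → Vec d'} {K : ℕ} (hξ : ∀ k < K, ‖ξ k‖ ≤ γ)
    (hd : ∀ k < K, ‖ξ' k - ξ k‖ ≤ e) :
    ∑ k ∈ Finset.range K, (sqNorm Q (ξ' k) + sqNorm R (ν k)) ≤
      ∑ k ∈ Finset.range K, (sqNorm Q (ξ k) + sqNorm R (ν k)) +
        K * (M * (2 * γ * e + e ^ 2)) := by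
  calc _ ≤ ∑ k ∈ Finset.range K,
        ((sqNorm Q (ξ k) + sqNorm R (ν k)) + M * (2 * γ * e + e ^ 2)) := by
        refine Finset.sum_le_sum fun k hk => ?_
        rw [Finset.mem_range] at hk
        have := sqNorm_sub_le_of_norm_sub_le Q hM (r := 0) (y := ξ k) (y' := ξ' k)
          (by simpa using hξ k hk) (hd k hk)
        simp only [sub_zero] at this
        linarith
    _ = _ := by
        rw [Finset.sum_add_distrib, Finset.sum_const, Finset.card_range, nsmul_eq_mul]

theorem sum_sqNorm_le_of_norm_le {d d' : ℕ} (Q : Matrix (Fin d) (Fin d) ℝ)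
    (R : Matrix (Fin d') (Fin d') ℝ) {M e : ℝ} (hQ : ‖Matrix.toEuclideanCLM (𝕜 := ℝ) Q‖ ≤ M)
    (hR : ‖Matrix.toEuclideanCLM (𝕜 := ℝ) R‖ ≤ M) {ξ : ℕ → Vec d} {ν : ℕ → Vec d'} {K : ℕ}
    (hξ : ∀ k < K, ‖ξ k‖ ≤ e) (hν : ∀ k < K, ‖ν k‖ ≤ e) :
    ∑ k ∈ Finset.range K, (sqNorm Q (ξ k) + sqNorm R (ν k)) ≤ K * (2 * (M * e ^ 2)) := by
  have hM₀ : 0 ≤ M := (norm_nonneg _).trans hQ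
  calc _ ≤ ∑ k ∈ Finset.range K, 2 * (M * e ^ 2) := by
        refine Finset.sum_le_sum fun k hk => ?_
        rw [Finset.mem_range] at hk
        rw [two_mul]
        exact add_le_add ((sqNorm_le _ hQ _).trans (by gcongr; exact hξ k hk))
          ((sqNorm_le _ hR _).trans (by gcongr; exact hν k hk))
    _ = _ := by rw [Finset.sum_const, Finset.card_range, nsmul_eq_mul]

namespace TrackingData

variable {n m p : ℕ} {P : TrackingData n m p}

/-! ### Prediction error of the linearized model -/

/-- Deviations of order √T keep the true state within O(√T) of the linearization point, so each step
adds a remainder of order T. The induction also keeps the state in the ball: the radius is R for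
`xs`, 1 for the deviation and 1 for the error. -/
theorem RegularOn.exists_prediction_error {R L g : ℝ}
    (hL : P.RegularOn (Metric.closedBall 0 (R + 2)) L) (hg : 0 < g) (k : ℕ) :
    ∃ c Tb : ℝ, 0 < c ∧ 0 < Tb ∧ ∀ T, 0 ≤ T → T ≤ Tb →
      ∀ (x : ℕ → Vec n) (xs : Vec n) (us : Vec m) (ν : ℕ → Vec m),
        (xs, us) ∈ P.ZsLin (x 0) → ‖xs‖ ≤ R →
        (∀ j ≤ k, ‖linTraj (P.A (x 0)) P.B (x 0 - xs) ν j‖ ≤ g * √T) →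
        (∀ j < k, x (j + 1) = P.f (x j) (us + ν j)) →
        ‖x k - (xs + linTraj (P.A (x 0)) P.B (x 0 - xs) ν k)‖ ≤ c * T ∧
          x k ∈ Metric.closedBall (0 : Vec n) (R + 2) := by
  have hmem {x xs ξ : Vec n} (h₁ : ‖x - (xs + ξ)‖ ≤ 1) (h₂ : ‖ξ‖ ≤ 1) (h₃ : ‖xs‖ ≤ R) :
      x ∈ Metric.closedBall (0 : Vec n) (R + 2) := by
    rw [mem_closedBall_zero_iff]
    calc ‖x‖ = ‖(x - (xs + ξ)) + (xs + ξ)‖ := by simp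
      _ ≤ 1 + (R + 1) := (norm_add_le _ _).trans
        (add_le_add h₁ ((norm_add_le _ _).trans (add_le_add h₃ h₂)))
      _ = R + 2 := by ring
  have hL₀ := hL.pos
  induction k with
  | zero =>
    refine ⟨1, (1 / g) ^ 2, one_pos, by positivity, fun T hT hTb x xs us ν hs hxs hξ _ => ?_⟩
    have h1 : x 0 - (xs + linTraj (P.A (x 0)) P.B (x 0 - xs) ν 0) = 0 := by simp
    rw [h1, norm_zero, one_mul]
    exact ⟨hT, hmem (by rw [h1]; simp)
      ((hξ 0 le_rfl).trans (mul_sqrt_le_of_le_div_sq hg zero_le_one hTb)) hxs⟩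
  | succ k ih =>
    obtain ⟨c, Tb, hc, hTb, ih⟩ := ih
    set c' := L * (c + 2 * g) ^ 2 + L * c with hc'
    have hc'₀ : 0 < c' := by positivity
    refine ⟨c', min (min Tb (1 / c')) (min 1 ((1 / g) ^ 2)), hc'₀, by positivity,
      fun T hT hle x xs us ν hs hxs hξ hx => ?_⟩
    simp only [le_min_iff] at hle
    obtain ⟨⟨hle₁, hle₂⟩, hle₃, hle₄⟩ := hle
    obtain ⟨herr, hxk⟩ := ih T hT hle₁ x xs us ν hs hxs (fun j hj => hξ j (by omega))
      (fun j hj => hx j (by omega))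
    have hz : x 0 ∈ Metric.closedBall (0 : Vec n) (R + 2) :=
      hmem (ξ := x 0 - xs) (by simp)
        ((hξ 0 (by omega)).trans (mul_sqrt_le_of_le_div_sq hg zero_le_one hle₄)) hxs
    set ξ := linTraj (P.A (x 0)) P.B (x 0 - xs) ν with hξdef
    have hdiff : ‖x k - x 0‖ ≤ (c + 2 * g) * √T := by
      have : x k - x 0 = (x k - (xs + ξ k)) + (ξ k - ξ 0) := by
        simp only [hξdef, linTraj_zero]
        abel
      rw [this]
      calc _ ≤ c * T + (g * √T + g * √T) := (norm_add_le _ _).trans (add_le_add herr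
            ((norm_sub_le _ _).trans (add_le_add (hξ k (by omega)) (hξ 0 (by omega)))))
        _ ≤ c * √T + (g * √T + g * √T) := by
          gcongr
          exact le_sqrt_of_le_one hT hle₃
        _ = _ := by ring
    have hstep : x (k + 1) - (xs + ξ (k + 1)) =
        (P.f₀ (x k) - P.f₀ (x 0) - P.A (x 0) (x k - x 0)) +
          P.A (x 0) (x k - (xs + ξ k)) := by
      rw [hx k (by omega), hξdef, linTraj_succ, ← P.fLin_add hs.2]
      simp only [f, fLin, e, map_sub, map_add]
      abel
    have herr' : ‖x (k + 1) - (xs + ξ (k + 1))‖ ≤ c' * T := by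
      rw [hstep]
      calc _ ≤ L * ((c + 2 * g) * √T) ^ 2 + L * (c * T) := by
            refine (norm_add_le _ _).trans (add_le_add
              ((hL.norm_f₀_sub_le _ hz _ hxk).trans (by gcongr)) ?_)
            exact ((P.A (x 0)).le_of_opNorm_le (hL.norm_A_le _ hz) _).trans (by gcongr)
        _ = c' * T := by
          rw [mul_pow, Real.sq_sqrt hT, hc']
          ring
    refine ⟨herr', hmem (herr'.trans ?_)
      ((hξ _ le_rfl).trans (mul_sqrt_le_of_le_div_sq hg zero_le_one hle₄)) hxs⟩
    rwa [mul_comm, ← le_div_iff₀ hc'₀]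

/-- The initial mismatch is O(T) by prediction error and transfer. The matrix mismatch is O(√T), but
it acts on deviations of order √T and so also contributes O(T). -/
theorem RegularOn.exists_shifted_trajectory {R L g : ℝ}
    (hL : P.RegularOn (Metric.closedBall 0 (R + 2)) L) (h₄ : P.NonsingularDynamics)
    (hN : n ≤ P.N) (hg : 0 < g) :
    ∃ c Tb : ℝ, 0 < c ∧ 0 < Tb ∧ ∀ T, 0 ≤ T → T ≤ Tb →
      ∀ (x : ℕ → Vec n) (xs : Vec n) (us : Vec m) (ν : ℕ → Vec m),
        (xs, us) ∈ P.ZsLin (x 0) → ‖xs‖ ≤ R →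
        (∀ j ≤ P.N, ‖linTraj (P.A (x 0)) P.B (x 0 - xs) ν j‖ ≤ g * √T) →
        (∀ j < n, x (j + 1) = P.f (x j) (us + ν j)) →
        x n ∈ Metric.closedBall (0 : Vec n) (R + 2) ∧ ∃ xs', (xs', us) ∈ P.ZsLin (x n) ∧
          ‖P.hLin (x n) xs' us - P.hLin (x 0) xs us‖ ≤ c * T ∧
          ∀ k ≤ P.N - n, ‖linTraj (P.A (x n)) P.B (x n - xs') (fun j => ν (n + j)) k -
            linTraj (P.A (x 0)) P.B (x 0 - xs) ν (n + k)‖ ≤ c * T := by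
  obtain ⟨c₁, T₁, hc₁, hT₁, hpred⟩ := hL.exists_prediction_error hg n
  -- The case of zero steps only serves to place `x 0` in the ball.
  obtain ⟨c₀, T₀, -, hT₀, hpred₀⟩ := hL.exists_prediction_error hg 0
  obtain ⟨c₂, hc₂, htransfer⟩ := h₄.exists_transfer hL
  have hL₀ := hL.pos
  set c₃ := c₂ * (g ^ 2 + (c₁ + g) ^ 2) with hc₃
  set c₄ := (L + 1) ^ P.N * (c₁ + c₃ + L * (c₁ + 2 * g) * g) with hc₄
  refine ⟨c₃ + c₄, min (min T₁ T₀) 1, by positivity, by positivity,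
    fun T hT hle x xs us ν hs hxs hξ hx => ?_⟩
  simp only [le_min_iff] at hle
  obtain ⟨⟨hle₁, hle₂⟩, hle₃⟩ := hle
  obtain ⟨herr, hxn⟩ := hpred T hT hle₁ x xs us ν hs hxs (fun j hj => hξ j (by omega)) hx
  obtain ⟨-, hz⟩ := hpred₀ T hT hle₂ x xs us ν hs hxs (fun j hj => hξ j (by omega))
    (fun j hj => by omega)
  have hxs' : xs ∈ Metric.closedBall (0 : Vec n) (R + 2) := by
    rw [mem_closedBall_zero_iff]
    linarith
  have hsq := Real.sq_sqrt hT
  have hTs := le_sqrt_of_le_one hT hle₃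
  set ξ := linTraj (P.A (x 0)) P.B (x 0 - xs) ν with hξdef
  have hξ₀ : ‖xs - x 0‖ ≤ g * √T := by
    rw [norm_sub_rev]
    exact hξ 0 (by omega)
  have hξn : ‖xs - x n‖ ≤ (c₁ + g) * √T := by
    have : xs - x n = -((x n - (xs + ξ n)) + ξ n) := by abel
    rw [this, norm_neg]
    calc _ ≤ c₁ * T + g * √T := (norm_add_le _ _).trans (add_le_add herr (hξ n hN))
      _ ≤ c₁ * √T + g * √T := by gcongr
      _ = _ := by ring
  have hc₃T : c₂ * (‖xs - x 0‖ ^ 2 + ‖xs - x n‖ ^ 2) ≤ c₃ * T := by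
    calc _ ≤ c₂ * ((g * √T) ^ 2 + ((c₁ + g) * √T) ^ 2) := by gcongr
      _ = c₃ * T := by
        rw [mul_pow, mul_pow, hsq, hc₃]
        ring
  obtain ⟨xs', hs', hdx, hdy⟩ := htransfer (x 0) hz (x n) hxn xs hxs' us hs
  have hc₄₀ : 0 ≤ c₄ := by positivity
  have hc₃₀ : 0 ≤ c₃ := by positivity
  refine ⟨hxn, xs', hs', (hdy.trans hc₃T).trans (by gcongr; linarith), fun k hk => ?_⟩
  have hA : ‖P.A (x n) - P.A (x 0)‖ ≤ L * ((c₁ + 2 * g) * √T) := by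
    refine (hL.norm_A_sub_le _ hz _ hxn).trans ?_
    gcongr
    have : x n - x 0 = (xs - x 0) - (xs - x n) := by abel
    rw [this]
    refine (norm_sub_le _ _).trans ((add_le_add hξ₀ hξn).trans (le_of_eq ?_))
    ring
  have hd₀ : ‖(x n - xs') - ξ n‖ ≤ (c₁ + c₃) * T := by
    have : (x n - xs') - ξ n = (x n - (xs + ξ n)) - (xs' - xs) := by abel
    rw [this, add_mul]
    exact (norm_sub_le _ _).trans (add_le_add herr (hdx.trans hc₃T))
  rw [hξdef, linTraj_add]
  calc _ ≤ (L + 1) ^ k * (‖(x n - xs') - ξ n‖ + L * ((c₁ + 2 * g) * √T) * (g * √T)) := by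
        refine norm_linTraj_sub_linTraj_le P.B (hL.norm_A_le _ hxn) hA (by positivity) _ _ _
          fun j hj => ?_
        rw [← linTraj_add]
        exact hξ _ (by omega)
    _ ≤ (L + 1) ^ P.N * ((c₁ + c₃) * T + L * ((c₁ + 2 * g) * √T) * (g * √T)) := by
        gcongr
        · linarith
        · omega
    _ = c₄ * T := by
        rw [hc₄]
        linear_combination (L + 1) ^ P.N * L * (c₁ + 2 * g) * g * hsq
    _ ≤ (c₃ + c₄) * T := by gcongr; linarith

/-! ### Decrease of the optimal cost -/


/-- The competitor shifts the plan by n steps, keeps `us`, moves the steady state to the new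
linearization and steers the O(T) terminal error to zero in the n free steps. -/
theorem exists_cost_decrease (hn : 0 < n) (hN : n ≤ P.N) (h₀ : P.Standing)
    (h₃ : P.UniformlyControllable) (h₄ : P.NonsingularDynamics) {R L : ℝ}
    (hL : P.RegularOn (Metric.closedBall 0 (R + 2)) L)
    (hR : ∀ z, ∀ w ∈ P.ZsLin z, ‖w.1‖ ≤ R) :
    ∃ κ Tb Sb : ℝ, 0 < κ ∧ 0 < Tb ∧ 0 < Sb ∧ ∀ S : Matrix (Fin p) (Fin p) ℝ,
      ‖Matrix.toEuclideanCLM (𝕜 := ℝ) S‖ ≤ Sb → ∀ (x : ℕ → Vec n) (u : ℕ → Vec m) (c),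
        P.IsOptimal S (x 0) c →
        (∀ j < n, x (j + 1) = P.f (x j) (u j)) → (∀ k : Fin P.N, (k : ℕ) < n → u k = c.u k) →
        P.cost S c - sqNorm S (P.hLin (x 0) c.xs c.us - P.yr) ≤ Tb →
        ∃ c', P.IsFeasiblePoint (x n) c' ∧ P.cost S c' ≤ P.cost S c -
          κ * (P.cost S c - sqNorm S (P.hLin (x 0) c.xs c.us - P.yr)) := by
  obtain ⟨q, M, hq, hM, hQq, hRq, hQM, hRM⟩ := h₀.exists_weight_bounds
  obtain ⟨ε, hε, hU⟩ := h₀.exists_margin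
  obtain ⟨G, hG, hst⟩ := h₃.exists_steering L
  obtain ⟨δ, Γ, hδ, hΓ, hcand⟩ := exists_steering_candidate h₀ h₃ hN hL
  obtain ⟨Y, hY, hYb⟩ := h₀.exists_norm_output_le hL Metric.isBounded_closedBall
  set g := (√q)⁻¹ with hg_def
  have hg : 0 < g := by positivity
  obtain ⟨c₁, T₁, hc₁, hT₁, hshift⟩ := hL.exists_shifted_trajectory h₄ hN hg
  -- The dropped stages are worth 4κT: 2κT pays for the perturbed tracking cost, κT for the setpoint
  -- cost, and κT remains.
  set κ := q / (4 * Γ) with hκ_def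
  have hκ : 0 < κ := by positivity
  set c₂ := P.N * (M * (2 * g * c₁ + c₁ ^ 2)) + n * (2 * (M * (G * c₁) ^ 2)) + 1 with hc₂_def
  have hc₂ : 0 < c₂ := by positivity
  -- The bounds on T ensure, in order: the shift estimates; T ≤ √T; ‖x 0 - xs‖ ≤ min δ 1; c₂ √T ≤
  -- 2κ; corrective inputs within the margin ε. The bound on S limits the setpoint increase to κT.
  refine ⟨κ, min (min T₁ 1) (min ((min δ 1 / g) ^ 2) (min ((2 * κ / c₂) ^ 2) (ε / (G * c₁)))),
    κ / (2 * Y * c₁ + c₁ ^ 2), hκ, by positivity, by positivity,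
    fun S hS x u c hopt hx hu hle => ?_⟩
  obtain ⟨ν, hν, hνU, hend, hcost⟩ := hopt.1.exists_input
  have hTdef : P.cost S c - sqNorm S (P.hLin (x 0) c.xs c.us - P.yr) =
      P.trackCost (x 0) c.xs ν := by rw [hcost]; ring
  rw [hTdef] at hle ⊢
  set T := P.trackCost (x 0) c.xs ν with hT_def
  have hT : 0 ≤ T := h₀.trackCost_nonneg _ _ _
  simp only [le_min_iff] at hle
  obtain ⟨⟨hle₁, hle₂⟩, hle₃, hle₄, hle₅⟩ := hle
  have hxs : ‖c.xs‖ ≤ R := hR (x 0) (c.xs, c.us) hopt.1.equil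
  have hsq := Real.sq_sqrt hT
  set ξ := linTraj (P.A (x 0)) P.B (x 0 - c.xs) ν with hξ_def
  have hξ : ∀ j ≤ P.N, ‖ξ j‖ ≤ g * √T := by
    intro j hj
    rcases hj.lt_or_eq with hj | rfl
    · have h1 := h₀.mul_norm_sq_le_trackCost hQq (x 0) c.xs ν hj
      refine le_of_sq_le_sq ?_ (by positivity)
      rw [mul_pow, hsq, hg_def, inv_pow, Real.sq_sqrt hq.le, inv_mul_eq_div, le_div_iff₀ hq,
        mul_comm]
      exact h1
    · rw [hend, norm_zero]
      positivity
  have hg1 : g * √T ≤ min δ 1 := mul_sqrt_le_of_le_div_sq hg (by positivity) hle₃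
  have hx0 : x 0 ∈ Metric.closedBall (0 : Vec n) (R + 2) := by
    rw [mem_closedBall_zero_iff]
    have h1 : ‖x 0 - c.xs‖ ≤ 1 := (hξ 0 (by omega)).trans (hg1.trans (min_le_right _ _))
    have h2 := norm_le_norm_add_norm_sub' (x 0) c.xs
    linarith
  -- Comparison with steering to the same steady state, so the setpoint terms cancel.
  have hTΓ : T ≤ Γ * ‖x 0 - c.xs‖ ^ 2 := by
    obtain ⟨c', hc', hcost'⟩ := hcand (x 0) hx0 c.xs c.us hopt.1.equil
      ((hξ 0 (by omega)).trans (hg1.trans (min_le_left _ _)))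
    have := (hopt.2 c' hc').trans (hcost' S)
    rw [hcost] at this
    linarith
  have hx' : ∀ j < n, x (j + 1) = P.f (x j) (c.us + ν j) := fun j hj => by
    rw [hx j hj, hu ⟨j, by omega⟩ hj, hν ⟨j, by omega⟩]
  obtain ⟨hxn, xs', hs', hdy, hd⟩ := hshift T hT hle₁ x c.xs c.us ν hopt.1.equil hxs hξ hx'
  set ξ' := linTraj (P.A (x n)) P.B (x n - xs') (fun j => ν (n + j)) with hξ'_def
  have hxi_end : ‖ξ' (P.N - n)‖ ≤ c₁ * T := by
    have := hd (P.N - n) le_rfl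
    rwa [Nat.add_sub_cancel' hN, ← hξ_def, hend, sub_zero] at this
  obtain ⟨w, hw, hwξ, hwend⟩ := hst (x n) (hL.norm_A_le _ hxn) (ξ' (P.N - n))
  let ν' : ℕ → Vec m := fun k => if k < P.N - n then ν (n + k) else w (k - (P.N - n))
  have hν'₁ (k) (hk : k < P.N - n) : ν' k = ν (n + k) := if_pos hk
  have hν'₂ (k) : ν' (P.N - n + k) = w k := by simp [ν']
  have htr₁ (k) (hk : k ≤ P.N - n) :
      linTraj (P.A (x n)) P.B (x n - xs') ν' k = ξ' k :=
    linTraj_congr _ _ _ fun j hj => hν'₁ j (by omega)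
  have htr₂ (k) : linTraj (P.A (x n)) P.B (x n - xs') ν' (P.N - n + k) =
      linTraj (P.A (x n)) P.B (ξ' (P.N - n)) w k := by
    rw [linTraj_add, htr₁ _ le_rfl]
    exact linTraj_congr _ _ _ fun j _ => hν'₂ j
  have hNn : P.N - n + n = P.N := Nat.sub_add_cancel hN
  obtain ⟨c', hc', hcost'⟩ := P.exists_isFeasiblePoint hs' (ν := ν') (fun k hk => by
      rcases lt_or_ge k (P.N - n) with hk' | hk'
      · rw [hν'₁ k hk']
        exact hνU _ (by omega)
      · obtain ⟨j, rfl⟩ := Nat.exists_eq_add_of_le hk'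
        rw [hν'₂]
        refine hU _ hs'.1 _ ((hw j).trans ?_)
        calc G * ‖ξ' (P.N - n)‖ ≤ G * (c₁ * T) := by gcongr
          _ = T * (G * c₁) := by ring
          _ ≤ ε := by rwa [← le_div_iff₀ (by positivity)])
    (by
      have := htr₂ n
      rw [hNn] at this
      rw [this, hwend n le_rfl])
  refine ⟨c', hc', ?_⟩
  rw [hcost', hcost]
  have hTs := le_sqrt_of_le_one hT hle₂
  have htrack : P.trackCost (x n) xs' ν' ≤ T - 2 * κ * T := by
    have hfirst : ∑ k ∈ Finset.range (P.N - n), (sqNorm P.Q (ξ' k) + sqNorm P.R (ν (n + k))) ≤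
        ∑ k ∈ Finset.range (P.N - n), (sqNorm P.Q (ξ (n + k)) + sqNorm P.R (ν (n + k))) +
          P.N * (M * (2 * g * c₁ + c₁ ^ 2)) * (√T * T) := by
      refine (sum_sqNorm_le_of_norm_sub_le P.Q P.R hQM (ξ := fun k => ξ (n + k)) (ξ' := ξ')
        (ν := fun k => ν (n + k)) (fun k hk => hξ (n + k) (by omega))
        (fun k hk => hd k hk.le)).trans (add_le_add le_rfl ?_)
      calc ((P.N - n : ℕ) : ℝ) * (M * (2 * (g * √T) * (c₁ * T) + (c₁ * T) ^ 2))
          ≤ P.N * (M * (2 * (g * √T) * (c₁ * T) + c₁ ^ 2 * (√T * T))) := by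
            gcongr
            · exact Nat.sub_le _ _
            · rw [mul_pow, sq T]
              gcongr
        _ = _ := by ring
    have hsecond : ∑ k ∈ Finset.range n,
        (sqNorm P.Q (linTraj (P.A (x n)) P.B (ξ' (P.N - n)) w k) + sqNorm P.R (w k)) ≤
          n * (2 * (M * (G * c₁) ^ 2)) * (√T * T) := by
      have hGe : G * ‖ξ' (P.N - n)‖ ≤ G * (c₁ * T) := by gcongr
      refine (sum_sqNorm_le_of_norm_le P.Q P.R hQM hRM (fun k _ => (hwξ k).trans hGe)
        (fun k _ => (hw k).trans hGe)).trans ?_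
      calc (n : ℝ) * (2 * (M * (G * (c₁ * T)) ^ 2)) = n * (2 * (M * (G * c₁) ^ 2)) * (T * T) := by
            ring
        _ ≤ _ := by gcongr
    have htail : ∑ k ∈ Finset.range (P.N - n),
        (sqNorm P.Q (ξ (n + k)) + sqNorm P.R (ν (n + k))) ≤ T - 4 * κ * T := by
      have hsplit : T = ∑ k ∈ Finset.range n, (sqNorm P.Q (ξ k) + sqNorm P.R (ν k)) +
          ∑ k ∈ Finset.range (P.N - n), (sqNorm P.Q (ξ (n + k)) + sqNorm P.R (ν (n + k))) := by
        rw [← Finset.sum_range_add, Nat.add_sub_cancel' hN]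
        rfl
      have hstage : q * ‖x 0 - c.xs‖ ^ 2 ≤
          ∑ k ∈ Finset.range n, (sqNorm P.Q (ξ k) + sqNorm P.R (ν k)) := by
        refine le_trans ?_ (Finset.single_le_sum
          (f := fun k => sqNorm P.Q (ξ k) + sqNorm P.R (ν k))
          (fun _ _ => h₀.stage_nonneg _ _) (Finset.mem_range.2 hn))
        exact (hQq _).trans (le_add_of_nonneg_right (sqNorm_nonneg h₀.posDef_R _))
      have hκT : 4 * κ * T ≤ q * ‖x 0 - c.xs‖ ^ 2 := by
        have : 4 * κ * Γ = q := by rw [hκ_def]; field_simp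
        calc 4 * κ * T ≤ 4 * κ * (Γ * ‖x 0 - c.xs‖ ^ 2) := by gcongr
          _ = _ := by rw [← mul_assoc, this]
      linarith
    have hsum : P.trackCost (x n) xs' ν' =
        ∑ k ∈ Finset.range (P.N - n), (sqNorm P.Q (ξ' k) + sqNorm P.R (ν (n + k))) +
        ∑ k ∈ Finset.range n,
          (sqNorm P.Q (linTraj (P.A (x n)) P.B (ξ' (P.N - n)) w k) + sqNorm P.R (w k)) := by
      conv_lhs => rw [trackCost, ← hNn, Finset.sum_range_add]
      congr 1
      · refine Finset.sum_congr rfl fun k hk => ?_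
        rw [Finset.mem_range] at hk
        rw [htr₁ k hk.le, hν'₁ k hk]
      · refine Finset.sum_congr rfl fun k _ => ?_
        rw [htr₂, hν'₂]
    have hsmall : c₂ * (√T * T) ≤ 2 * κ * T := by
      rw [← mul_assoc]
      refine mul_le_mul_of_nonneg_right ?_ hT
      exact mul_sqrt_le_of_le_div_sq hc₂ (by positivity) hle₄
    have hc₂' : (P.N * (M * (2 * g * c₁ + c₁ ^ 2)) + n * (2 * (M * (G * c₁) ^ 2))) * (√T * T) ≤
        c₂ * (√T * T) := by
      gcongr
      rw [hc₂_def]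
      linarith
    rw [hsum]
    linarith
  have hout : sqNorm S (P.hLin (x n) xs' c.us - P.yr) ≤
      sqNorm S (P.hLin (x 0) c.xs c.us - P.yr) + κ * T := by
    have hxs2 : c.xs ∈ Metric.closedBall (0 : Vec n) (R + 2) := by
      rw [mem_closedBall_zero_iff]
      linarith
    refine (sqNorm_sub_le_of_norm_sub_le S hS (hYb _ hx0 _ hxs2 _ hopt.1.equil.1) hdy).trans
      (add_le_add le_rfl ?_)
    calc κ / (2 * Y * c₁ + c₁ ^ 2) * (2 * Y * (c₁ * T) + (c₁ * T) ^ 2)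
        = κ / (2 * Y * c₁ + c₁ ^ 2) * (2 * Y * (c₁ * T) + c₁ ^ 2 * (T * T)) := by ring
      _ ≤ κ / (2 * Y * c₁ + c₁ ^ 2) * (2 * Y * (c₁ * T) + c₁ ^ 2 * (1 * T)) := by gcongr
      _ = κ / (2 * Y * c₁ + c₁ ^ 2) * (2 * Y * c₁ + c₁ ^ 2) * T := by ring
      _ = κ * T := by rw [div_mul_cancel₀ _ (by positivity)]
  linarith

end TrackingData

/-! ### A Lyapunov argument for sequences with decreasing cost -/

/-- `J` need not dominate `Js` a priori. Summing the decrease gives T → 0, and `hlow` along the tail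
of the decreasing sequence `J` yields Js ≤ J. The decrease then gives both claims. -/
theorem geometric_decay_of_cost_decrease {J T : ℕ → ℝ} {Js κ C C' : ℝ} (hκ : 0 < κ)
    (hC : κ < C) (hJ₀ : ∀ i, 0 ≤ J i) (hT : ∀ i, 0 ≤ T i)
    (hdec : ∀ i, J (i + 1) ≤ J i - κ * T i) (hup : ∀ i, J i - Js ≤ C * T i)
    (hlow : ∀ i, Js ≤ J i + C' * T i) (i : ℕ) :
    κ * T i ≤ J i - Js ∧ J i - Js ≤ (1 - κ / C) ^ i * (J 0 - Js) := by
  have hC₀ : 0 < C := hκ.trans hC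
  have hanti : Antitone J := antitone_nat_of_succ_le fun i => by nlinarith [hdec i, hT i]
  have hsum : Summable fun i => κ * T i := by
    refine summable_of_sum_range_le (c := J 0) (fun i => mul_nonneg hκ.le (hT i)) fun k => ?_
    have : ∑ i ∈ Finset.range k, κ * T i ≤ J 0 - J k := by
      induction k with
      | zero => simp
      | succ k ih =>
        rw [Finset.sum_range_succ]
        linarith [hdec k]
    linarith [hJ₀ k]
  have hT₀ : Filter.Tendsto T Filter.atTop (nhds 0) := by
    have := hsum.tendsto_atTop_zero.const_mul κ⁻¹
    simpa [inv_mul_cancel_left₀ hκ.ne'] using this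
  have hnonneg (i) : Js ≤ J i := by
    have h1 : Filter.Tendsto (fun k => J i + C' * T k) Filter.atTop (nhds (J i + C' * 0)) :=
      tendsto_const_nhds.add (hT₀.const_mul C')
    rw [mul_zero, add_zero] at h1
    refine ge_of_tendsto h1 (Filter.eventually_atTop.2 ⟨i, fun k hk => ?_⟩)
    linarith [hlow k, hanti hk]
  refine ⟨by linarith [hdec i, hnonneg (i + 1)], ?_⟩
  induction i with
  | zero => simp
  | succ i ih =>
    have h1 : κ / C * (J i - Js) ≤ κ * T i := by
      rw [div_mul_eq_mul_div, div_le_iff₀ hC₀]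
      nlinarith [hup i]
    have h2 : 0 ≤ 1 - κ / C := by
      rw [sub_nonneg, div_le_one hC₀]
      exact hC.le
    calc J (i + 1) - Js ≤ (1 - κ / C) * (J i - Js) := by linarith [hdec i]
      _ ≤ (1 - κ / C) * ((1 - κ / C) ^ i * (J 0 - Js)) := by gcongr
      _ = _ := by ring

/-! ### Tracking part of the cost and equilibrium estimates -/

namespace TrackingData

variable {n m p : ℕ} {P : TrackingData n m p}

/-- The tracking part of the cost of a candidate at the state `z`. -/
noncomputable def trackingPart (P : TrackingData n m p) (S : Matrix (Fin p) (Fin p) ℝ)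
    (z : Vec n) (c : Candidate n m p P.N) : ℝ :=
  P.cost S c - sqNorm S (P.hLin z c.xs c.us - P.yr)

theorem Standing.trackingPart_nonneg (h : P.Standing) (S : Matrix (Fin p) (Fin p) ℝ) {z : Vec n}
    {c : Candidate n m p P.N} (hc : P.IsFeasiblePoint z c) : 0 ≤ P.trackingPart S z c := by
  obtain ⟨ν, -, -, -, hcost⟩ := hc.exists_input
  rw [trackingPart, hcost, add_sub_cancel_right]
  exact h.trackCost_nonneg _ _ _

theorem Standing.mul_norm_sq_le_trackingPart (h : P.Standing) {q : ℝ}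
    (hq : ∀ v, q * ‖v‖ ^ 2 ≤ sqNorm P.Q v) (hN : 0 < P.N) (S : Matrix (Fin p) (Fin p) ℝ)
    {z : Vec n} {c : Candidate n m p P.N} (hc : P.IsFeasiblePoint z c) :
    q * ‖z - c.xs‖ ^ 2 ≤ P.trackingPart S z c := by
  obtain ⟨ν, -, -, -, hcost⟩ := hc.exists_input
  rw [trackingPart, hcost, add_sub_cancel_right]
  have h1 := h.mul_norm_sq_le_trackCost hq z c.xs ν (k := 0) hN
  rwa [linTraj_zero] at h1

/-! ### Optimal reachable equilibria -/

theorem exists_isOptEquilLin (h : P.Standing) {K : Set (Vec n × Vec m)}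
    (hK : P.CompactSteadyStates K) (S : Matrix (Fin p) (Fin p) ℝ) {z : Vec n}
    (hz : (P.ZsLin z).Nonempty) : ∃ x u, P.IsOptEquilLin S z x u := by
  have hcomp : IsCompact (P.ZsLin z) :=
    hK.1.of_isClosed_subset (P.isClosed_ZsLin h z) (hK.2.2 z)
  have hcont : Continuous fun w : Vec n × Vec m => sqNorm S (P.hLin z w.1 w.2 - P.yr) := by
    refine (continuous_sqNorm S).comp ?_
    unfold hLin
    fun_prop
  obtain ⟨w, hw, hmin⟩ := hcomp.exists_isMinOn hz hcont.continuousOn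
  refine ⟨w.1, w.2, hw, ?_⟩
  rintro y ⟨w', hw', rfl⟩
  exact hmin hw'

/-- The optimal reachable equilibrium of the nonlinear system is also optimal for the system
linearized at it. -/
theorem IsOptEquil.le_of_mem_ZsLin (h : P.Standing) {K : Set (Vec n × Vec m)}
    (hK : P.CompactSteadyStates K) {S : Matrix (Fin p) (Fin p) ℝ} {xsr : Vec n} {usr : Vec m}
    (hopt : P.IsOptEquil S xsr usr) {X : Set (Vec n)} (hX : IsCompact X) (hKX : K ⊆ X ×ˢ P.U)
    (hxX : xsr ∈ X) (hdist : P.DistancesEquivalent S K xsr) {x : Vec n} {u : Vec m}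
    (hx : (x, u) ∈ P.ZsLin xsr) :
    sqNorm S (P.h xsr usr - P.yr) ≤ sqNorm S (P.hLin xsr x u - P.yr) := by
  obtain ⟨x', u', hopt'⟩ := exists_isOptEquilLin h hK S ⟨_, hx⟩
  obtain ⟨c₁, c₂, hc₁, -, hd⟩ := hdist X hX hKX
  -- At z = xsr the equivalence of distances forces the linearized optimum to have state xsr. It is
  -- then a nonlinear steady state and competes with `usr`.
  have h1 := (hd xsr hxX x' u' hopt').1
  have h2 : ‖xsr - x'‖ = 0 := by
    have h3 : c₁ * ‖xsr - x'‖ ^ 2 ≤ 0 := by simpa using h1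
    have h4 : ‖xsr - x'‖ ^ 2 ≤ 0 := by nlinarith [sq_nonneg ‖xsr - x'‖]
    exact pow_eq_zero_iff two_ne_zero |>.1 (le_antisymm h4 (sq_nonneg _))
  obtain rfl : xsr = x' := sub_eq_zero.1 (norm_eq_zero.1 h2)
  refine (hopt.2 (P.h xsr u') ⟨(xsr, u'), P.mem_Zs_iff_mem_ZsLin_self.2 hopt'.1, rfl⟩).trans ?_
  rw [← hLin_self]
  exact hopt'.2 _ ⟨(x, u), hx, rfl⟩

/-- Optimality of the artificial steady state bounds its distance to the optimal reachable
equilibrium of the linearized system by its distance to the current state. -/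
theorem exists_dist_optEquilLin_le (h₀ : P.Standing) (h₂ : P.UniqueSteadyState)
    (h₃ : P.UniformlyControllable) (hN : n ≤ P.N) {X : Set (Vec n)} {R L : ℝ}
    (hL : P.RegularOn X L) (hR : ∀ z, ∀ w ∈ P.ZsLin z, ‖w.1‖ ≤ R) :
    ∃ δ : ℝ, 0 < δ ∧ ∀ S : Matrix (Fin p) (Fin p) ℝ, S.PosDef → ∃ C : ℝ, 0 < C ∧
      ∀ z ∈ X, ∀ c, P.IsOptimal S z c → ‖z - c.xs‖ ≤ δ → ∀ x u, P.IsOptEquilLin S z x u →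
        ‖c.xs - x‖ ^ 2 ≤ C * ‖z - c.xs‖ ^ 2 := by
  obtain ⟨δ, Γ, hδ, hΓ, hcand⟩ := exists_steering_candidate h₀ h₃ hN hL
  obtain ⟨σ, hσ, hblock⟩ := h₂.exists_mul_norm_le
  refine ⟨δ / 2, by positivity, fun S hS => ?_⟩
  obtain ⟨l, hl, hlS⟩ := exists_pos_mul_norm_sq_le_sqNorm hS
  set s := l * σ ^ 2 with hs_def
  have hs : 0 < s := by positivity
  -- Moving a fraction b towards the optimum gains at least b s D² / 2 and costs at most 2Γ‖z - xs‖²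
  -- + 2Γ b² D². The second bound on b makes the b² term at most half the gain; the third keeps the
  -- moved point within δ of z.
  set b := min (1 / 2) (min (s / (8 * Γ)) (δ / 2 / (2 * |R| + 1))) with hb_def
  have hb : 0 < b := by positivity
  have hb₁ : b ≤ 1 / 2 := min_le_left _ _
  have hb₂ : b * (8 * Γ) ≤ s := by
    rw [← le_div_iff₀ (by positivity)]
    exact (min_le_right _ _).trans (min_le_left _ _)
  have hb₃ : b * (2 * |R| + 1) ≤ δ / 2 := by
    rw [← le_div_iff₀ (by positivity)]
    exact (min_le_right _ _).trans (min_le_right _ _)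
  refine ⟨8 * Γ / (b * s), by positivity, fun z hz c hc hle x u hx => ?_⟩
  set D := ‖c.xs - x‖ with hD_def
  have hDR : D ≤ 2 * |R| + 1 := by
    have h1 : ‖c.xs‖ ≤ R := hR z (c.xs, c.us) hc.1.equil
    have h2 : ‖x‖ ≤ R := hR z (x, u) hx.1
    have h3 := norm_sub_le c.xs x
    have h4 := le_abs_self R
    linarith
  have hmem := P.convexCombination_mem_ZsLin h₀.convex_Us hc.1.equil hx.1 hb.le (by linarith)
  have hdist : ‖z - ((1 - b) • c.xs + b • x)‖ ≤ ‖z - c.xs‖ + b * D := by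
    have : z - ((1 - b) • c.xs + b • x) = (z - c.xs) + b • (c.xs - x) := by module
    rw [this]
    refine (norm_add_le _ _).trans ?_
    rw [norm_smul, Real.norm_of_nonneg hb.le]
  obtain ⟨c', hc', hcost'⟩ := hcand z hz _ _ hmem (by
    have : b * D ≤ b * (2 * |R| + 1) := by gcongr
    linarith)
  have h1 := (hc.2 c' hc').trans (hcost' S)
  have hout : P.hLin z ((1 - b) • c.xs + b • x) ((1 - b) • c.us + b • u) - P.yr =
      (1 - b) • (P.hLin z c.xs c.us - P.yr) + b • (P.hLin z x u - P.yr) := by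
    rw [hLin_convexCombination]
    module
  rw [hout, sqNorm_convexCombination] at h1
  have h2 : sqNorm S (P.hLin z x u - P.yr) ≤ sqNorm S (P.hLin z c.xs c.us - P.yr) :=
    hx.2 _ ⟨(c.xs, c.us), hc.1.equil, rfl⟩
  have h3 := h₀.trackingPart_nonneg S hc.1
  rw [trackingPart] at h3
  have h4 : s * D ^ 2 ≤
      sqNorm S (P.hLin z c.xs c.us - P.yr - (P.hLin z x u - P.yr)) := by
    refine le_trans ?_ (hlS _)
    have h5 : P.hLin z c.xs c.us - P.yr - (P.hLin z x u - P.yr) =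
        P.C z (c.xs - x) + P.D (c.us - u) := by
      simp only [hLin, map_sub]
      abel
    have h6 : c.xs - x = P.A z (c.xs - x) + P.B (c.us - u) := by
      nth_rw 1 [((P.mem_ZsLin_iff).1 hc.1.equil).2, ((P.mem_ZsLin_iff).1 hx.1).2]
      simp only [fLin, map_sub]
      abel
    rw [h5, hs_def, mul_assoc, ← mul_pow]
    gcongr
    exact hblock z _ _ h6
  have h7 : Γ * ‖z - ((1 - b) • c.xs + b • x)‖ ^ 2 ≤
      2 * Γ * ‖z - c.xs‖ ^ 2 + b * (8 * Γ) * (b * D ^ 2) / 4 := by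
    calc _ ≤ Γ * (‖z - c.xs‖ + b * D) ^ 2 := by gcongr
      _ ≤ Γ * (2 * (‖z - c.xs‖ ^ 2 + (b * D) ^ 2)) := by
        gcongr
        exact add_sq_le
      _ = _ := by ring
  have h8 : b * (8 * Γ) * (b * D ^ 2) ≤ s * (b * D ^ 2) := by gcongr
  have h9 : b * (1 / 2) * (s * D ^ 2) ≤ b * (1 - b) *
      sqNorm S (P.hLin z c.xs c.us - P.yr - (P.hLin z x u - P.yr)) := by
    have hb' : 0 < 1 - b := by linarith
    gcongr
    linarith
  have h10 := mul_le_mul_of_nonneg_left h2 hb.le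
  rw [div_mul_eq_mul_div, le_div_iff₀ (by positivity)]
  linarith

/-! ### The optimal cost near the optimal reachable equilibrium -/

/-- Relinearizing at z moves the optimal equilibrium by O(‖z - xsr‖²), since the model at xsr is
exact there; then steer to the moved equilibrium. -/
theorem exists_candidate_near_equilibrium (h₀ : P.Standing) (h₃ : P.UniformlyControllable)
    (h₄ : P.NonsingularDynamics) (hN : n ≤ P.N) {X : Set (Vec n)} {L : ℝ}
    (hL : P.RegularOn X L) (hX : Bornology.IsBounded X) (S : Matrix (Fin p) (Fin p) ℝ)
    {xsr : Vec n} {usr : Vec m} (hs : (xsr, usr) ∈ P.Zs) (hxsr : xsr ∈ X) :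
    ∃ δ C : ℝ, 0 < δ ∧ 0 < C ∧ ∀ z ∈ X, ‖z - xsr‖ ≤ δ → ∃ c, P.IsFeasiblePoint z c ∧
      P.cost S c ≤ sqNorm S (P.h xsr usr - P.yr) + C * ‖z - xsr‖ ^ 2 := by
  obtain ⟨δ, Γ, hδ, hΓ, hcand⟩ := exists_steering_candidate h₀ h₃ hN hL
  obtain ⟨Y, hY, hYb⟩ := h₀.exists_norm_output_le hL hX
  obtain ⟨a, ha, htransfer⟩ := h₄.exists_transfer hL
  set M := ‖Matrix.toEuclideanCLM (𝕜 := ℝ) S‖ with hM_def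
  have hM : 0 ≤ M := norm_nonneg _
  refine ⟨min 1 (δ / (1 + a)), Γ * (1 + a) ^ 2 + M * (2 * Y * a + a ^ 2), by positivity,
    by positivity, fun z hz hle => ?_⟩
  rw [le_min_iff] at hle
  have hs' := P.mem_Zs_iff_mem_ZsLin_self.1 hs
  obtain ⟨x', hx', hdx, hdy⟩ := htransfer xsr hxsr z hz xsr hxsr usr hs'
  rw [sub_self, norm_zero, zero_pow two_ne_zero, zero_add, norm_sub_rev xsr z] at hdx hdy
  set t := ‖z - xsr‖ with ht_def
  have ht : 0 ≤ t := norm_nonneg _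
  have htt : t ^ 2 ≤ t := by nlinarith [hle.1]
  have hdz : ‖z - x'‖ ≤ (1 + a) * t := by
    have : z - x' = (z - xsr) - (x' - xsr) := by abel
    rw [this]
    refine (norm_sub_le _ _).trans ((add_le_add le_rfl hdx).trans ?_)
    nlinarith
  obtain ⟨c, hc, hcost⟩ := hcand z hz x' usr hx' (hdz.trans (by
    rw [mul_comm, ← le_div_iff₀ (by positivity)]
    exact hle.2))
  refine ⟨c, hc, (hcost S).trans ?_⟩
  have h1 := sqNorm_sub_le_of_norm_sub_le S (le_refl M)
    (hYb xsr hxsr xsr hxsr usr hs.1) hdy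
  rw [hLin_self] at h1
  have h2 : Γ * ‖z - x'‖ ^ 2 ≤ Γ * ((1 + a) * t) ^ 2 := by gcongr
  have h3 : M * (2 * Y * (a * t ^ 2) + (a * t ^ 2) ^ 2) ≤ M * ((2 * Y * a + a ^ 2) * t ^ 2) := by
    gcongr
    have : (a * t ^ 2) ^ 2 ≤ a ^ 2 * t ^ 2 := by
      rw [mul_pow]
      gcongr
    linarith
  calc _ ≤ Γ * ((1 + a) * t) ^ 2 + (sqNorm S (P.h xsr usr - P.yr) +
        M * ((2 * Y * a + a ^ 2) * t ^ 2)) := by linarith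
    _ = _ := by ring

/-- Near the optimal reachable equilibrium, the distance to it, the suboptimality and the tracking
part of the optimal cost are comparable. The threshold `δ` does not depend on `S`. -/
theorem exists_optimal_cost_estimates (hn : 0 < n) (hN : n ≤ P.N) (h₀ : P.Standing)
    (h₂ : P.UniqueSteadyState) (h₃ : P.UniformlyControllable) (h₄ : P.NonsingularDynamics)
    {K : Set (Vec n × Vec m)} (h₅ : P.CompactSteadyStates K) {X : Set (Vec n)} {R L : ℝ}
    (hX : IsCompact X) (hKX : K ⊆ X ×ˢ P.U) (hL : P.RegularOn X L)
    (hR : ∀ z, ∀ w ∈ P.ZsLin z, ‖w.1‖ ≤ R) :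
    ∃ δ : ℝ, 0 < δ ∧ ∀ S : Matrix (Fin p) (Fin p) ℝ, S.PosDef → ∀ xsr usr,
      P.IsOptEquil S xsr usr → P.DistancesEquivalent S K xsr → ∃ C₁ C₂ C₃ : ℝ,
        0 < C₁ ∧ 0 < C₂ ∧ 0 < C₃ ∧ ∀ z ∈ X, ∀ c, P.IsOptimal S z c → P.cost S c ≤ 1 →
          ‖z - c.xs‖ ≤ δ →
            ‖z - xsr‖ ^ 2 ≤ C₁ * P.trackingPart S z c ∧
            P.cost S c - sqNorm S (P.h xsr usr - P.yr) ≤ C₂ * ‖z - xsr‖ ^ 2 ∧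
            sqNorm S (P.h xsr usr - P.yr) ≤ P.cost S c + C₃ * P.trackingPart S z c := by
  obtain ⟨q, M', hq, -, hqQ, -, -, -⟩ := h₀.exists_weight_bounds
  obtain ⟨δ, hδ, hD⟩ := exists_dist_optEquilLin_le h₀ h₂ h₃ hN hL hR
  obtain ⟨Y, hY, hYb⟩ := h₀.exists_norm_output_le hL hX.isBounded
  obtain ⟨a, ha, htransfer⟩ := h₄.exists_transfer hL
  refine ⟨δ, hδ, fun S hS xsr usr hopt hdist => ?_⟩
  have hZX {z x : Vec n} {u : Vec m} (hx : (x, u) ∈ P.ZsLin z) : x ∈ X :=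
    (hKX (h₅.2.2 z hx)).1
  have hxsr : xsr ∈ X := hZX (P.mem_Zs_iff_mem_ZsLin_self.1 hopt.1)
  obtain ⟨C, hC, hD⟩ := hD S hS
  obtain ⟨c₁, c₂, -, hc₂, hde⟩ := hdist X hX hKX
  obtain ⟨δ', Γ, hδ', hΓ, hnear⟩ := exists_candidate_near_equilibrium h₀ h₃ h₄ hN hL hX.isBounded
    S hopt.1 hxsr
  set M := ‖Matrix.toEuclideanCLM (𝕜 := ℝ) S‖ with hM_def
  have hM : 0 ≤ M := norm_nonneg _
  set C₁ := c₂ * (2 * (1 + C)) / q with hC₁_def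
  have hC₁ : 0 < C₁ := by positivity
  set g := a * (q⁻¹ + 2 * (q⁻¹ + C₁)) with hg_def
  have hg : 0 < g := by positivity
  refine ⟨C₁, max Γ ((δ' ^ 2)⁻¹), M * (2 * Y * g + g ^ 2) + 1, hC₁, by positivity,
    by positivity, fun z hz c hc hc1 hle => ?_⟩
  set T := P.trackingPart S z c with hT_def
  have hT : 0 ≤ T := h₀.trackingPart_nonneg S hc.1
  have hout : 0 ≤ sqNorm S (P.hLin z c.xs c.us - P.yr) := sqNorm_nonneg hS _
  have hcostT : P.cost S c = T + sqNorm S (P.hLin z c.xs c.us - P.yr) := by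
    rw [hT_def, trackingPart]
    ring
  have hT1 : T ≤ 1 := by linarith
  have hzx : ‖z - c.xs‖ ^ 2 ≤ q⁻¹ * T := by
    rw [inv_mul_eq_div, le_div_iff₀ hq, mul_comm]
    exact h₀.mul_norm_sq_le_trackingPart hqQ (by omega) S hc.1
  have hzxsr : ‖z - xsr‖ ^ 2 ≤ C₁ * T := by
    obtain ⟨x, u, hx⟩ := exists_isOptEquilLin h₀ h₅ S ⟨_, hc.1.equil⟩
    have h1 := hD z hz c hc hle x u hx
    have h2 : ‖z - x‖ ^ 2 ≤ 2 * (‖z - c.xs‖ ^ 2 + ‖c.xs - x‖ ^ 2) :=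
      (pow_le_pow_left₀ (norm_nonneg _) (norm_sub_le_norm_sub_add_norm_sub _ c.xs _) 2).trans
        add_sq_le
    calc ‖z - xsr‖ ^ 2 ≤ c₂ * ‖z - x‖ ^ 2 := (hde z hz x u hx).2
      _ ≤ c₂ * (2 * (‖z - c.xs‖ ^ 2 + C * ‖z - c.xs‖ ^ 2)) := by
        gcongr
        linarith
      _ = c₂ * (2 * (1 + C)) * ‖z - c.xs‖ ^ 2 := by ring
      _ ≤ c₂ * (2 * (1 + C)) * (q⁻¹ * T) := by gcongr
      _ = C₁ * T := by
        rw [hC₁_def]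
        ring
  refine ⟨hzxsr, ?_, ?_⟩
  · rcases le_or_gt ‖z - xsr‖ δ' with hz' | hz'
    · obtain ⟨c', hc', hcost'⟩ := hnear z hz hz'
      have h1 : Γ * ‖z - xsr‖ ^ 2 ≤ max Γ ((δ' ^ 2)⁻¹) * ‖z - xsr‖ ^ 2 := by
        gcongr
        exact le_max_left _ _
      linarith [hc.2 c' hc']
    -- Away from xsr the bound cost ≤ 1 suffices, which explains `(δ' ^ 2)⁻¹` in the constant.
    · have h1 : 1 ≤ max Γ ((δ' ^ 2)⁻¹) * ‖z - xsr‖ ^ 2 := by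
        calc (1 : ℝ) = (δ' ^ 2)⁻¹ * δ' ^ 2 := by field_simp
          _ ≤ _ := by
            gcongr
            exact le_max_right _ _
      linarith [sqNorm_nonneg hS (P.h xsr usr - P.yr)]
  -- Transferred to the linearization at xsr, where Js is optimal, the artificial steady state costs
  -- at least Js; the transfer changes its output by O(T).
  · obtain ⟨x', hx', -, hdy⟩ := htransfer z hz xsr hxsr c.xs (hZX hc.1.equil) c.us hc.1.equil
    have h1 := hopt.le_of_mem_ZsLin h₀ h₅ hX hKX hxsr hdist hx'
    have h2 : a * (‖c.xs - z‖ ^ 2 + ‖c.xs - xsr‖ ^ 2) ≤ g * T := by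
      have h3 : ‖c.xs - xsr‖ ^ 2 ≤ 2 * (‖c.xs - z‖ ^ 2 + ‖z - xsr‖ ^ 2) :=
        (pow_le_pow_left₀ (norm_nonneg _) (norm_sub_le_norm_sub_add_norm_sub _ z _) 2).trans
          add_sq_le
      rw [norm_sub_rev] at hzx
      calc _ ≤ a * (q⁻¹ * T + 2 * (q⁻¹ * T + C₁ * T)) := by
            gcongr
            linarith
        _ = g * T := by
          rw [hg_def]
          ring
    have h4 := sqNorm_sub_le_of_norm_sub_le S (le_refl M)
      (hYb z hz c.xs (hZX hc.1.equil) c.us hc.1.equil.1) (hdy.trans h2)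
    have h5 : M * (2 * Y * (g * T) + (g * T) ^ 2) ≤ M * ((2 * Y * g + g ^ 2) * T) := by
      gcongr
      have : (g * T) ^ 2 ≤ g ^ 2 * T := by
        rw [mul_pow]
        gcongr
        nlinarith
      linarith
    linarith

/-! ### The closed loop -/

/-- The artificial steady state competes in the problem defining `JeqLin`. -/
theorem trackingPart_le_V {S : Matrix (Fin p) (Fin p) ℝ} (hS : S.PosDef) {z : Vec n}
    {c : Candidate n m p P.N} (hc : P.IsOptimal S z c) : P.trackingPart S z c ≤ P.V S z := by
  refine sub_le_sub ?_ ?_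
  · refine le_csInf ⟨_, c, hc.1, rfl⟩ ?_
    rintro _ ⟨c', hc', rfl⟩
    exact hc.2 c' hc'
  · refine csInf_le ⟨0, ?_⟩ ⟨_, ⟨_, hc.1.equil, rfl⟩, rfl⟩
    rintro _ ⟨y, -, rfl⟩
    exact sqNorm_nonneg hS _

end TrackingData

/-! ### Main theorem -/

open TrackingData in
theorem theorem1 {n m p : ℕ} (P : TrackingData n m p) (hN : n ≤ P.N)
    (h₀ : P.Standing) (h₁ : P.Smooth) (h₂ : P.UniqueSteadyState)
    (h₃ : P.UniformlyControllable) (h₄ : P.NonsingularDynamics)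
    (K : Set (Vec n × Vec m)) (h₅ : P.CompactSteadyStates K) :
    ∃ Vmax : ℝ, 0 < Vmax ∧ ∃ Sbar : ℝ, 0 < Sbar ∧
      ∀ (S : Matrix (Fin p) (Fin p) ℝ) (hS : S.PosDef),
        (∀ i, hS.isHermitian.eigenvalues i ≤ Sbar) →
        ∀ (xsr : Vec n) (usr : Vec m), P.IsOptEquil S xsr usr → P.DistancesEquivalent S K xsr →
        ∃ C cV : ℝ, 0 < C ∧ 0 < cV ∧ cV < 1 ∧
          ∀ (x : ℕ → Vec n) (u : ℕ → Vec m), P.IsClosedLoop S x u →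
            P.Feasible (x 0) → P.V S (x 0) ≤ Vmax →
            ∀ i : ℕ, P.Feasible (x (n * i)) ∧
              ‖x (n * i) - xsr‖ ^ 2 ≤ cV ^ i * C * ‖x 0 - xsr‖ ^ 2 := by
  rcases Nat.eq_zero_or_pos n with rfl | hn
  · refine ⟨1, one_pos, 1, one_pos, fun S hS _ xsr usr _ _ =>
      ⟨1, 1 / 2, one_pos, by norm_num, by norm_num, fun x u _ hfeas _ i => ?_⟩⟩
    rw [zero_mul, Subsingleton.elim (x 0) xsr]
    exact ⟨Subsingleton.elim (x 0) xsr ▸ hfeas, by simp⟩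
  obtain ⟨R, hR⟩ := h₅.1.isBounded.exists_norm_le
  set X := Metric.closedBall (0 : Vec n) (R + 2) with hX_def
  have hX : IsCompact X := isCompact_closedBall _ _
  have hKX : K ⊆ X ×ˢ P.U := fun w hw => by
    refine ⟨?_, (h₅.2.1 hw).2⟩
    rw [hX_def, mem_closedBall_zero_iff]
    linarith [hR w hw, norm_fst_le w]
  have hRZ : ∀ z, ∀ w ∈ P.ZsLin z, ‖w.1‖ ≤ R := fun z w hw =>
    (norm_fst_le w).trans (hR w (h₅.2.2 z hw))
  obtain ⟨L, hL⟩ := h₁.exists_regularOn hX (convex_closedBall _ _)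
  obtain ⟨q, M, hq, -, hqQ, -, -, -⟩ := h₀.exists_weight_bounds
  obtain ⟨Y, hY, hYb⟩ := h₀.exists_norm_output_le hL hX.isBounded
  obtain ⟨κ, Tb, Sb, hκ, hTb, hSb, hdec⟩ := exists_cost_decrease hn hN h₀ h₃ h₄ hL hRZ
  obtain ⟨δ, hδ, hest⟩ := exists_optimal_cost_estimates hn hN h₀ h₂ h₃ h₄ h₅ hX hKX hL hRZ
  -- Cost at most τ puts the state in X, within δ of the artificial steady state, and T below the
  -- decrease threshold. It is independent of S, as Vmax must be.
  set τ := min (min Tb 1) (q * (min δ 1) ^ 2) with hτ_def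
  have hτ : 0 < τ := by positivity
  -- Half of τ is for the tracking part, bounded by V; the other half is for the setpoint term,
  -- bounded by λ_max(S) Y².
  refine ⟨τ / 2, by positivity, min Sb (τ / 2 / Y ^ 2), by positivity,
    fun S hS hSle xsr usr hopt hdist => ?_⟩
  have hSnorm : ‖Matrix.toEuclideanCLM (𝕜 := ℝ) S‖ ≤ min Sb (τ / 2 / Y ^ 2) :=
    norm_toEuclideanCLM_le hS (by positivity) hSle
  obtain ⟨C₁, C₂, C₃, hC₁, hC₂, hC₃, hest⟩ := hest S hS xsr usr hopt hdist
  set Js := sqNorm S (P.h xsr usr - P.yr) with hJs_def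
  -- C₂ C₁ already bounds (J - Js) / T; adding κ makes 1 - κ / c₀ positive.
  set c₀ := C₂ * C₁ + κ with hc₀_def
  have hc₀ : κ < c₀ := by
    rw [hc₀_def]
    linarith [mul_pos hC₂ hC₁]
  refine ⟨C₁ / κ * C₂, 1 - κ / c₀, by positivity, ?_, ?_, fun x u hcl hfeas hV => ?_⟩
  · rw [sub_pos, div_lt_one (hκ.trans hc₀)]
    exact hc₀
  · have := div_pos hκ (hκ.trans hc₀)
    linarith
  have hbounds {z : Vec n} {c : Candidate n m p P.N} (hc : P.IsFeasiblePoint z c)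
      (hT : P.trackingPart S z c ≤ τ) :
      P.trackingPart S z c ≤ Tb ∧ ‖z - c.xs‖ ≤ δ ∧ z ∈ X := by
    simp only [hτ_def, le_min_iff] at hT
    have h1 := h₀.mul_norm_sq_le_trackingPart hqQ (by omega) S hc
    have h2 : ‖z - c.xs‖ ≤ min δ 1 :=
      le_of_sq_le_sq (le_of_mul_le_mul_left (h1.trans hT.2) hq) (by positivity)
    refine ⟨hT.1.1, h2.trans (min_le_left _ _), ?_⟩
    rw [hX_def, mem_closedBall_zero_iff]
    have h3 : ‖c.xs‖ ≤ R := hRZ z (c.xs, c.us) hc.equil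
    have h4 := norm_le_norm_add_norm_sub' z c.xs
    have h5 := h2.trans (min_le_right _ _)
    linarith
  have htp_le (z : Vec n) (c : Candidate n m p P.N) : P.trackingPart S z c ≤ P.cost S c :=
    sub_le_self _ (sqNorm_nonneg hS _)
  have hstart : ∀ c, P.IsOptimal S (x 0) c → P.cost S c ≤ τ := by
    intro c hc
    have h1 : P.trackingPart S (x 0) c ≤ τ / 2 := (trackingPart_le_V hS hc).trans hV
    obtain ⟨-, -, hx0⟩ := hbounds hc.1 (by linarith)
    have h2 := (sqNorm_le S (hSnorm.trans (min_le_right _ _))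
      (P.hLin (x 0) c.xs c.us - P.yr)).trans (mul_le_mul_of_nonneg_left
        (pow_le_pow_left₀ (norm_nonneg _) (hYb (x 0) hx0 c.xs
          (hKX (h₅.2.2 _ hc.1.equil)).1 c.us hc.1.equil.1) 2) (by positivity))
    rw [div_mul_cancel₀ _ (by positivity)] at h2
    rw [trackingPart] at h1
    linarith
  have hstep : ∀ i c, P.IsOptimal S (x (n * i)) c → P.cost S c ≤ τ →
      (∀ k : Fin P.N, (k : ℕ) < n → u (n * i + k) = c.u k) →
      ∃ c', P.IsFeasiblePoint (x (n * (i + 1))) c' ∧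
        P.cost S c' ≤ P.cost S c - κ * P.trackingPart S (x (n * i)) c := by
    intro i c hc hcτ hu
    obtain ⟨hT, -, -⟩ := hbounds hc.1 ((htp_le _ _).trans hcτ)
    exact hdec S (hSnorm.trans (min_le_left _ _)) (fun j => x (n * i + j)) (fun j => u (n * i + j))
      c hc (fun j _ => hcl.dyn _) hu hT
  -- The bound holds for every optimal solution, so it persists whichever one the scheme selects.
  have hall : ∀ i, P.Feasible (x (n * i)) ∧ ∀ c, P.IsOptimal S (x (n * i)) c → P.cost S c ≤ τ := by
    intro i
    induction i with
    | zero => exact ⟨hfeas, hstart⟩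
    | succ i ih =>
      obtain ⟨c, hc, hu⟩ := hcl.input i (exists_isOptimal h₀ h₅ S ih.1)
      obtain ⟨c', hc', hcost'⟩ := hstep i c hc (ih.2 c hc) hu
      refine ⟨⟨c', hc'⟩, fun c'' hc'' => ?_⟩
      have h1 := mul_nonneg hκ.le (h₀.trackingPart_nonneg S hc.1)
      linarith [hc''.2 c' hc', ih.2 c hc]
  choose c hc hu using fun i => hcl.input i (exists_isOptimal h₀ h₅ S (hall i).1)
  have hτc (i) : P.cost S (c i) ≤ τ := (hall i).2 _ (hc i)
  have hE (i) := by
    obtain ⟨-, h1, h2⟩ := hbounds (hc i).1 ((htp_le _ _).trans (hτc i))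
    exact hest _ h2 (c i) (hc i)
      ((hτc i).trans ((min_le_left _ _).trans (min_le_right _ _))) h1
  have hT (i) := h₀.trackingPart_nonneg S (hc i).1
  intro i
  refine ⟨(hall i).1, ?_⟩
  obtain ⟨h1, h2⟩ := geometric_decay_of_cost_decrease (J := fun i => P.cost S (c i))
    (T := fun i => P.trackingPart S (x (n * i)) (c i)) (Js := Js) (C := c₀) (C' := C₃) hκ hc₀
    (fun i => (hT i).trans (htp_le _ _)) hT
    (fun i => by
      obtain ⟨c', hc', hcost'⟩ := hstep i (c i) (hc i) (hτc i) (hu i)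
      exact ((hc (i + 1)).2 c' hc').trans hcost')
    (fun i => by
      have h3 := mul_le_mul_of_nonneg_left (hE i).1 hC₂.le
      have h4 := mul_nonneg hκ.le (hT i)
      rw [hc₀_def]
      linarith [(hE i).2.1])
    (fun i => (hE i).2.2) i
  have h3 : P.cost S (c 0) - Js ≤ C₂ * ‖x 0 - xsr‖ ^ 2 := (hE 0).2.1
  have h4 : 0 ≤ 1 - κ / c₀ := by
    rw [sub_nonneg, div_le_one (hκ.trans hc₀)]
    exact hc₀.le
  calc ‖x (n * i) - xsr‖ ^ 2 ≤ C₁ / κ * (κ * P.trackingPart S (x (n * i)) (c i)) := by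
        rw [← mul_assoc, div_mul_cancel₀ _ hκ.ne']
        exact (hE i).1
    _ ≤ C₁ / κ * ((1 - κ / c₀) ^ i * (C₂ * ‖x 0 - xsr‖ ^ 2)) := by
        refine mul_le_mul_of_nonneg_left (h1.trans (h2.trans ?_)) (by positivity)
        gcongr
    _ = _ := by ring
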